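/- **Setting.** Let $E$ be a finite-dimensional $\mathbb{Q}$-vector space with a positive definite symmetric bilinear form $(\;,\;)$, put $\alpha^\vee=\frac{2}{(\alpha,\alpha)}\alpha$ for $0\ne\alpha\in E$, and let $\Phi\subseteq E$ be an irreducible reduced crystallographic root system spanning $E$, with simple roots $\{\alpha_i\mid i\in I\}$, simple reflections $s_i(v)=v-(v,\alpha_i^\vee)\alpha_i$, and Weyl group $W$. Let $\Lambda$ be the weight lattice, i.e. the $\mathbb{Z}$-span of the basis of $E$ dual to $\{\alpha_i^\vee\mid i\in I\}$. A minuscule weight is a nonzero $\lambda\in\Lambda$ with $(\lambda,\alpha_i^\vee)\ge 0$ for all $i\in I$ and $(\lambda,\alpha^\vee)\in\{0,\pm1\}$ for all $\alpha\in\Phi$. Let $\Psi\subseteq\Lambda$ be a non-empty union of $W$-orbits of minuscule weights, and let $M$ be a $\mathbb{C}$-vector space with basis $\{z_\mu\mid\mu\in\Psi\}$. For $i\in I$ define linear maps $e_i,f_i\colon M\to M$ by $$e_i(z_\mu)=\begin{cases}z_{\mu+\alpha_i}&\text{if }(\mu,\alpha_i^\vee)=-1,\\0&\text{otherwise,}\end{cases}\qquad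 f_i(z_\mu)=\begin{cases}z_{\mu-\alpha_i}&\text{if }(\mu,\alpha_i^\vee)=1,\\0&\text{otherwise,}\end{cases}$$ and put $n_i=(\mathrm{id}_M+e_i)(\mathrm{id}_M-f_i)(\mathrm{id}_M+e_i)\in\mathrm{GL}(M)$. For each $\alpha\in\Phi$ choose $k\ge0$ and $i,i_1,\dots,i_k\in I$ with $\alpha=s_{i_1}\cdots s_{i_k}(\alpha_i)$, and set $$\mathbf{e}_\alpha:=n_{i_1}\cdots n_{i_k}\,e_i\,n_{i_k}^{-1}\cdots n_{i_1}^{-1}.$$ **Proposition 2.5.** Let the elements $\mathbf{e}_\alpha$ be obtained from any such choice, and let $\alpha,\beta\in\Phi$ with $\beta\neq\pm\alpha$. (a) If $\alpha+\beta\notin\Phi$, then $[\mathbf{e}_\alpha,\mathbf{e}_\beta]=0$ and $\mathbf{e}_\beta\mathbf{e}_\alpha\mathbf{e}_\beta=0$. (b) If $\alpha+\beta\in\Phi$, then $[\mathbf{e}_\alpha,\mathbf{e}_\beta]=c\,\mathbf{e}_{\alpha+\beta}$ for some $c\in\{\pm1,\pm2\}$, where $c=\pm2$ if and only if $\alpha-\beta\in\Phi$.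 (c) If $\alpha+\beta\in\Phi$ and $2\alpha+\beta\notin\Phi$, then $xy=0$ for all $x,y\in\{\mathbf{e}_\alpha,\;[\mathbf{e}_\alpha,\mathbf{e}_\beta],\;\mathbf{e}_\beta\mathbf{e}_\alpha\mathbf{e}_\beta\}$. Furthermore, $\mathbf{e}_\beta\mathbf{e}_\alpha\mathbf{e}_\beta=c'\,\mathbf{e}_{\alpha+2\beta}$ for some sign $c'=\pm1$ if $\alpha+2\beta\in\Phi$, and $\mathbf{e}_\beta\mathbf{e}_\alpha\mathbf{e}_\beta=0$ if $\alpha+2\beta\notin\Phi$. -/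

import Mathlib

noncomputable section

namespace MinusculeModel

open Module

variable {ι E N : Type*} [AddCommGroup E] [Module ℚ E] [AddCommGroup N] [Module ℚ N]

/-! In what follows `P` is a root system over `ℚ` in `E`; the number `(v, α^∨)`, for `v` in `E` and
`α = P.root i`, is `P.coroot' i v`. A set of simple roots is a base `b` of `P`. -/

/-- The set `Φ` of roots, as a subset of `E`. -/
def roots (P : RootPairing ι ℚ E N) : Set E := Set.range P.root

open Classical in
/-- The fundamental weights: the basis of `E` dual to the simple coroots. -/
def fundamentalWeights {P : RootPairing ι ℚ E N} (b : P.Base) : Set E :=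
  {ϖ | ∃ i ∈ b.support, ∀ j ∈ b.support, P.coroot' j ϖ = if j = i then 1 else 0}

/-- The weight lattice `Λ`. -/
def weightLattice {P : RootPairing ι ℚ E N} (b : P.Base) : Submodule ℤ E :=
  Submodule.span ℤ (fundamentalWeights b)

/-- A minuscule weight: a nonzero dominant weight `v` with `(v, α^∨) ∈ {0, 1, -1}` for all roots
`α`. -/
structure IsMinuscule {P : RootPairing ι ℚ E N} (b : P.Base) (v : E) : Prop where
  mem_weightLattice : v ∈ weightLattice b
  ne_zero : v ≠ 0
  dominant : ∀ i ∈ b.support, 0 ≤ P.coroot' i v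
  pairing_mem : ∀ k : ι, P.coroot' k v ∈ ({0, 1, -1} : Set ℚ)

/-- `Ψ` is a non-empty union of Weyl group orbits of minuscule weights. -/
def IsUnionOfMinusculeOrbits {P : RootPairing ι ℚ E N} (b : P.Base) (Ψ : Set E) : Prop :=
  Ψ.Nonempty ∧
    ∃ S : Set E, (∀ v ∈ S, IsMinuscule b v) ∧ Ψ = ⋃ v ∈ S, MulAction.orbit P.weylGroup v

theorem IsUnionOfMinusculeOrbits.reflection_mem {P : RootPairing ι ℚ E N} {b : P.Base} {Ψ : Set E}
    (hΨ : IsUnionOfMinusculeOrbits b Ψ) {μ : E} (hμ : μ ∈ Ψ) (i : ι) : P.reflection i μ ∈ Ψ := by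
  obtain ⟨-, S, -, rfl⟩ := hΨ
  simp only [Set.mem_iUnion] at hμ ⊢
  obtain ⟨v, hv, hμ⟩ := hμ
  refine ⟨v, hv, ?_⟩
  have h := (MulAction.mem_orbit_of_mem_orbit (RootPairing.weylGroup.ofIdx P i) hμ)
  simpa using h

/-- If `(μ, α_i^∨) = -1`, then `μ + α_i` is again in `Ψ`. -/
theorem IsUnionOfMinusculeOrbits.add_mem {P : RootPairing ι ℚ E N} {b : P.Base} {Ψ : Set E}
    (hΨ : IsUnionOfMinusculeOrbits b Ψ) {μ : E} (hμ : μ ∈ Ψ) {i : ι} (h : P.coroot' i μ = -1) :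
    μ + P.root i ∈ Ψ := by
  have := hΨ.reflection_mem hμ i
  rwa [RootPairing.reflection_apply, h, neg_one_smul, sub_neg_eq_add] at this

/-- If `(μ, α_i^∨) = 1`, then `μ - α_i` is again in `Ψ`. -/
theorem IsUnionOfMinusculeOrbits.sub_mem {P : RootPairing ι ℚ E N} {b : P.Base} {Ψ : Set E}
    (hΨ : IsUnionOfMinusculeOrbits b Ψ) {μ : E} (hμ : μ ∈ Ψ) {i : ι} (h : P.coroot' i μ = 1) :
    μ - P.root i ∈ Ψ := by
  have := hΨ.reflection_mem hμ i
  rwa [RootPairing.reflection_apply, h, one_smul] at this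

variable {V : Type*} [AddCommGroup V] [Module ℂ V] {Ψ : Set E}

open Classical in
/-- The basis vector `z_v` for `v` in `Ψ`; the value for `v` outside `Ψ` is irrelevant, since the
two theorems above show that the vectors `z_{μ ± α_i}` used below have their index in `Ψ`. -/
def basisVec (z : Basis Ψ ℂ V) (v : E) : V := if h : v ∈ Ψ then z ⟨v, h⟩ else 0

open Classical in
/-- `e_i (z_μ) = z_{μ + α_i}` if `(μ, α_i^∨) = -1`, and `0` otherwise. -/
def eOp (P : RootPairing ι ℚ E N) (z : Basis Ψ ℂ V) (i : ι) : End ℂ V :=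
  z.constr ℂ fun μ => if P.coroot' i (μ : E) = -1 then basisVec z (μ + P.root i) else 0

open Classical in
/-- `f_i (z_μ) = z_{μ - α_i}` if `(μ, α_i^∨) = 1`, and `0` otherwise. -/
def fOp (P : RootPairing ι ℚ E N) (z : Basis Ψ ℂ V) (i : ι) : End ℂ V :=
  z.constr ℂ fun μ => if P.coroot' i (μ : E) = 1 then basisVec z (μ - P.root i) else 0

theorem eOp_mul_self (P : RootPairing ι ℚ E N) (z : Basis Ψ ℂ V) (i : ι) :
    eOp P z i * eOp P z i = 0 := by
  refine z.ext fun μ => ?_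
  rw [Module.End.mul_apply]
  simp only [eOp, Basis.constr_basis, LinearMap.zero_apply]
  split_ifs with h
  · unfold basisVec
    split_ifs with hm
    · rw [Basis.constr_basis, if_neg]
      rw [map_add, h, RootPairing.root_coroot'_eq_pairing, RootPairing.pairing_same]
      norm_num
    · exact map_zero _
  · exact map_zero _

theorem fOp_mul_self (P : RootPairing ι ℚ E N) (z : Basis Ψ ℂ V) (i : ι) :
    fOp P z i * fOp P z i = 0 := by
  refine z.ext fun μ => ?_
  rw [Module.End.mul_apply]
  simp only [fOp, Basis.constr_basis, LinearMap.zero_apply]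
  split_ifs with h
  · unfold basisVec
    split_ifs with hm
    · rw [Basis.constr_basis, if_neg]
      rw [map_sub, h, RootPairing.root_coroot'_eq_pairing, RootPairing.pairing_same]
      norm_num
    · exact map_zero _
  · exact map_zero _

/-- For `a * a = 0`, the invertible map `id + t a`, whose inverse is `id - t a`. -/
def oneAddSmul (a : End ℂ V) (ha : a * a = 0) (t : ℂ) : LinearMap.GeneralLinearGroup ℂ V where
  val := 1 + t • a
  inv := 1 - t • a
  val_inv := by
    rw [add_mul, mul_sub, mul_sub, smul_mul_smul_comm, ha]; simp
  inv_val := by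
    rw [sub_mul, mul_add, mul_add, smul_mul_smul_comm, ha]; simp

/-- The element `n_i = (id + e_i)(id - f_i)(id + e_i)` of `GL(V)`. -/
def nOp (P : RootPairing ι ℚ E N) (z : Basis Ψ ℂ V) (i : ι) : LinearMap.GeneralLinearGroup ℂ V :=
  oneAddSmul (eOp P z i) (eOp_mul_self P z i) 1 * oneAddSmul (fOp P z i) (fOp_mul_self P z i) (-1) *
    oneAddSmul (eOp P z i) (eOp_mul_self P z i) 1

/-- `e` assigns to each root `α` an operator
`n_{i_1} ⋯ n_{i_k} e_i n_{i_k}⁻¹ ⋯ n_{i_1}⁻¹`, for some choice of simple indices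
`i, i_1, …, i_k` (with `k ≥ 0`) such that `α = s_{i_1} ⋯ s_{i_k} (α_i)`.
The values of `e` at vectors that are not roots are irrelevant. -/
def IsRootVectorChoice {P : RootPairing ι ℚ E N} (b : P.Base) (z : Basis Ψ ℂ V)
    (e : E → End ℂ V) : Prop :=
  ∀ α ∈ roots P, ∃ (i : b.support) (l : List b.support),
    α = (l.map fun j : b.support => P.reflection j.1).prod (P.root i) ∧
    e α = (l.map fun j : b.support => nOp P z j.1).prod.val * eOp P z i *
      (l.map fun j : b.support => nOp P z j.1).prod⁻¹.val

end MinusculeModel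

end

/-!
The `e_i` and `f_i` generate a Lie algebra with a triangular decomposition, so all its weights are
sums of simple roots or negatives of such sums, and each simple root space is a line. Conjugation by
`n_i` permutes the weight spaces as `s_i` permutes the weights. Hence no weight other than `0` lies
outside `Φ`: a mixed sum of simple roots that is a weight is lowered by simple reflections until it
becomes a root. By the same conjugation every root space is spanned by its `𝐞_α`.

A bracket of root vectors therefore vanishes or is a multiple of a root vector. Each `𝐞_α` sends
`z_μ` to `± z_{μ + α}` or to `0`. If `(α, β) < 0` and `α ≠ -β`, then `[𝐞_α, 𝐞_β]` has the same
shape, and so has `𝐞_β 𝐞_α 𝐞_β` if `(α, β^∨) = -2`; hence the multiple is a sign there. The factor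
`2` arises when `α` and `β` are orthogonal with `τ = α - β` a root: then `𝐞_α = ± [𝐞_τ, 𝐞_β]`, and
`𝐞_β² = 0` gives `[𝐞_β, [𝐞_β, 𝐞_τ]] = -2 𝐞_β 𝐞_τ 𝐞_β`.
-/

namespace MinusculeModel

attribute [local instance] LieRing.ofAssociativeRing

open Module

section LieSpan

variable {K A : Type*} [CommRing K] [LieRing A] [LieAlgebra K A]

theorem lieSpan_le_of_forall_lie_mem {s : Set A} {T : Submodule K A} (hs : s ⊆ T)
    (h : ∀ x ∈ s, ∀ y ∈ T, ⁅x, y⁆ ∈ T) : (LieSubalgebra.lieSpan K A s).toSubmodule ≤ T := by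
  suffices H : ∀ x ∈ LieSubalgebra.lieSpan K A s, x ∈ T ∧ ∀ y ∈ T, ⁅x, y⁆ ∈ T from
    fun x hx => (H x hx).1
  intro x hx
  induction hx using LieSubalgebra.lieSpan_induction with
  | mem x hx => exact ⟨hs hx, h x hx⟩
  | zero => simp
  | add x y _ _ hx hy =>
    exact ⟨add_mem hx.1 hy.1, fun w hw => by
      rw [add_lie]; exact add_mem (hx.2 w hw) (hy.2 w hw)⟩
  | smul a x _ hx =>
    exact ⟨T.smul_mem a hx.1, fun w hw => by rw [smul_lie]; exact T.smul_mem a (hx.2 w hw)⟩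
  | lie x y _ _ hx hy =>
    exact ⟨hx.2 y hy.1, fun w hw => by
      rw [lie_lie]; exact sub_mem (hx.2 _ (hy.2 w hw)) (hy.2 _ (hx.2 w hw))⟩

theorem lie_mem_lieSpan_of_forall {s : Set A} {a : A}
    (h : ∀ x ∈ s, ⁅a, x⁆ ∈ LieSubalgebra.lieSpan K A s) :
    ∀ x ∈ LieSubalgebra.lieSpan K A s, ⁅a, x⁆ ∈ LieSubalgebra.lieSpan K A s := by
  intro x hx
  induction hx using LieSubalgebra.lieSpan_induction with
  | mem x hx => exact h x hx
  | zero => simp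
  | add x y _ _ hx hy => rw [lie_add]; exact add_mem hx hy
  | smul t x _ hx => rw [lie_smul]; exact LieSubalgebra.smul_mem _ t hx
  | lie x y hx hy ihx ihy =>
    rw [leibniz_lie]
    exact add_mem (LieSubalgebra.lie_mem _ ihx hy) (LieSubalgebra.lie_mem _ hx ihy)

theorem lie_mem_lieSpan_sup {s : Set A} {H : Submodule K A}
    (hH : ∀ h ∈ H, ∀ x ∈ s, ⁅h, x⁆ ∈ LieSubalgebra.lieSpan K A s) {a : A}
    (ha : ∀ x ∈ s, ⁅a, x⁆ ∈ H) {x : A} (hx : x ∈ LieSubalgebra.lieSpan K A s) :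
    ⁅a, x⁆ ∈ (LieSubalgebra.lieSpan K A s).toSubmodule ⊔ H := by
  have lie_mem {u y : A} (hu : u ∈ (LieSubalgebra.lieSpan K A s).toSubmodule ⊔ H)
      (hy : y ∈ LieSubalgebra.lieSpan K A s) : ⁅u, y⁆ ∈ LieSubalgebra.lieSpan K A s := by
    obtain ⟨v, hv, h, hh, rfl⟩ := Submodule.mem_sup.1 hu
    rw [add_lie]
    exact add_mem (LieSubalgebra.lie_mem _ hv hy) (lie_mem_lieSpan_of_forall (hH h hh) y hy)
  induction hx using LieSubalgebra.lieSpan_induction with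
  | mem x hx => exact Submodule.mem_sup_right (ha x hx)
  | zero => simp
  | add x y _ _ hx hy => rw [lie_add]; exact add_mem hx hy
  | smul t x _ hx => rw [lie_smul]; exact Submodule.smul_mem _ t hx
  | lie x y hx hy ihx ihy =>
    rw [leibniz_lie, ← lie_skew x]
    exact Submodule.mem_sup_left (add_mem (lie_mem ihx hy) (neg_mem (lie_mem ihy hx)))

theorem lieSpan_union_le {s t : Set A} {H : Submodule K A} (hst : ∀ x ∈ s, ∀ y ∈ t, ⁅x, y⁆ ∈ H)
    (hs : ∀ h ∈ H, ∀ x ∈ s, ⁅h, x⁆ ∈ LieSubalgebra.lieSpan K A s)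
    (ht : ∀ h ∈ H, ∀ y ∈ t, ⁅h, y⁆ ∈ LieSubalgebra.lieSpan K A t) :
    (LieSubalgebra.lieSpan K A (s ∪ t)).toSubmodule ≤
      (LieSubalgebra.lieSpan K A s).toSubmodule ⊔
        (LieSubalgebra.lieSpan K A t).toSubmodule ⊔ H := by
  set S := LieSubalgebra.lieSpan K A s
  set T := LieSubalgebra.lieSpan K A t
  have hsS : s ⊆ S := LieSubalgebra.subset_lieSpan
  have htT : t ⊆ T := LieSubalgebra.subset_lieSpan
  have hS : S.toSubmodule ≤ S.toSubmodule ⊔ T.toSubmodule ⊔ H := le_sup_left.trans le_sup_left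
  have hT : T.toSubmodule ≤ S.toSubmodule ⊔ T.toSubmodule ⊔ H := le_sup_right.trans le_sup_left
  have hSH : S.toSubmodule ⊔ H ≤ S.toSubmodule ⊔ T.toSubmodule ⊔ H :=
    sup_le_sup_right le_sup_left _
  have hTH : T.toSubmodule ⊔ H ≤ S.toSubmodule ⊔ T.toSubmodule ⊔ H :=
    sup_le_sup_right le_sup_right _
  have hts : ∀ y ∈ t, ∀ x ∈ s, ⁅y, x⁆ ∈ H := fun y hy x hx => by
    rw [← lie_skew]; exact neg_mem (hst x hx y hy)
  refine lieSpan_le_of_forall_lie_mem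
    (Set.union_subset (hsS.trans hS) (htT.trans hT)) fun x hx w hw => ?_
  obtain ⟨y, hy, h, hh, rfl⟩ := Submodule.mem_sup.1 hw
  obtain ⟨u, hu, v, hv, rfl⟩ := Submodule.mem_sup.1 hy
  rw [lie_add, lie_add, ← lie_skew x h]
  rcases hx with hx | hx
  · have hxu := hS (S.lie_mem (hsS hx) hu)
    have hxv := hTH (lie_mem_lieSpan_sup ht (hst x hx) hv)
    exact add_mem (add_mem hxu hxv) (neg_mem (hS (hs h hh x hx)))
  · have hxu := hSH (lie_mem_lieSpan_sup hs (hts x hx) hu)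
    have hxv := hT (T.lie_mem (htT hx) hv)
    exact add_mem (add_mem hxu hxv) (neg_mem (hT (ht h hh x hx)))

end LieSpan

theorem inf_iSup_le_of_iSupIndep {α κ : Type*} [CompleteLattice α] [IsModularLattice α]
    {G T : κ → α} (hG : iSupIndep G) (hT : T ≤ G) (k : κ) : G k ⊓ ⨆ j, T j ≤ T k := by
  have hsplit : ⨆ j, T j ≤ T k ⊔ ⨆ j, ⨆ (_ : j ≠ k), G j := iSup_le fun j => by
    by_cases hj : j = k
    · exact hj ▸ le_sup_left
    · exact (hT j).trans (le_sup_of_le_right (le_iSup₂_of_le j hj le_rfl))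
  calc G k ⊓ ⨆ j, T j ≤ (T k ⊔ ⨆ j, ⨆ (_ : j ≠ k), G j) ⊓ G k := by
        rw [inf_comm]; exact inf_le_inf_right _ hsplit
    _ = T k ⊔ (⨆ j, ⨆ (_ : j ≠ k), G j) ⊓ G k := sup_inf_assoc_of_le _ (hT k)
    _ = T k := by rw [(hG k).symm.eq_bot, sup_bot_eq]

section AdWeightSpace

variable {K A E : Type*} [Field K] [LieRing A] [LieAlgebra K A] [AddCommGroup E] [Module ℚ E]
  {h : Dual ℚ E → A} {γ δ : E} {X Y : A}

/-- The weight space of weight `γ` in a Lie algebra on which the functionals `φ` on `E` act through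
`ad (h φ)`: the vectors on which `ad (h φ)` is multiplication by `φ γ`, for all `φ`. -/
def adWeightSpace (K : Type*) {A E : Type*} [Field K] [LieRing A] [LieAlgebra K A]
    [AddCommGroup E] [Module ℚ E] (h : Dual ℚ E → A) (γ : E) : Submodule K A :=
  ⨅ φ : Dual ℚ E, (LieAlgebra.ad K A (h φ)).eigenspace (φ γ : K)

theorem mem_adWeightSpace :
    X ∈ adWeightSpace K h γ ↔ ∀ φ : Dual ℚ E, ⁅h φ, X⁆ = (φ γ : K) • X := by
  simp [adWeightSpace]

theorem lie_mem_adWeightSpace [CharZero K] (hX : X ∈ adWeightSpace K h γ)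
    (hY : Y ∈ adWeightSpace K h δ) : ⁅X, Y⁆ ∈ adWeightSpace K h (γ + δ) := by
  rw [mem_adWeightSpace] at *
  intro φ
  rw [leibniz_lie, hX, hY, smul_lie, lie_smul, ← add_smul, map_add, Rat.cast_add]

theorem iSupIndep_adWeightSpace [CharZero K] (hh : ∀ φ ψ, ⁅h φ, h ψ⁆ = 0) :
    iSupIndep (adWeightSpace K h) := by
  have hcomm (φ ψ : Dual ℚ E) : Commute (LieAlgebra.ad K A (h φ)) (LieAlgebra.ad K A (h ψ)) := by
    rw [commute_iff_lie_eq, ← LieHom.map_lie, hh, map_zero]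
  have hindep := Module.End.independent_iInf_maxGenEigenspace_of_forall_mapsTo
    (fun φ : Dual ℚ E => LieAlgebra.ad K A (h φ))
    fun φ ψ c => Module.End.mapsTo_maxGenEigenspace_of_comm (hcomm ψ φ) c
  have hinj : Function.Injective fun (γ : E) (φ : Dual ℚ E) => ((φ γ : ℚ) : K) := fun γ δ hγδ =>
    eval_apply_injective ℚ (LinearMap.ext fun φ => Rat.cast_injective (congrFun hγδ φ))
  refine (hindep.comp hinj).mono fun γ => ?_
  exact iInf_mono fun φ => Module.End.eigenspace_le_maxGenEigenspace

end AdWeightSpace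

section MixedSum

variable {I E : Type*} [AddCommGroup E] {r : I → E} {γ δ : E} {i : I}

/-- `γ` is a sum of vectors `r i` (with repetitions) in which at least two different indices occur;
for linearly independent `r` this says that `γ` is a nonnegative integral combination of the `r i`
but not a multiple of one of them. -/
def IsMixedSum (r : I → E) (γ : E) : Prop :=
  ∃ n : I →₀ ℕ, (∃ i j, i ≠ j ∧ n i ≠ 0 ∧ n j ≠ 0) ∧ Finsupp.linearCombination ℕ r n = γ

theorem isMixedSum_neg_left : IsMixedSum (-r) γ ↔ IsMixedSum r (-γ) := by
  have hneg (n : I →₀ ℕ) :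
      Finsupp.linearCombination ℕ (-r) n = -Finsupp.linearCombination ℕ r n := by
    simp [Finsupp.linearCombination_apply, Finsupp.sum]
  simp only [IsMixedSum, hneg, neg_eq_iff_eq_neg]

theorem isMixedSum_add_of_ne {i j : I} (h : i ≠ j) : IsMixedSum r (r i + r j) :=
  ⟨Finsupp.single i 1 + Finsupp.single j 1, ⟨i, j, h, by simp, by simp⟩, by simp⟩

theorem IsMixedSum.generator_add (i : I) (h : IsMixedSum r γ) : IsMixedSum r (r i + γ) := by
  obtain ⟨n, ⟨j, k, hjk, hj, hk⟩, rfl⟩ := h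
  exact ⟨Finsupp.single i 1 + n, ⟨j, k, hjk, by simp [hj], by simp [hk]⟩, by simp⟩

theorem IsMixedSum.add_ne_nsmul (hr : LinearIndependent ℕ r) (h : IsMixedSum r γ) (n : I →₀ ℕ)
    (m : ℕ) (i : I) : γ + Finsupp.linearCombination ℕ r n ≠ m • r i := by
  classical
  obtain ⟨n', ⟨j, k, hjk, hj, hk⟩, rfl⟩ := h
  intro heq
  have hn : n' + n = Finsupp.single i m := hr (by simpa using heq)
  have hval (l : I) (hl : n' l ≠ 0) : i = l := by
    by_contra hil
    have := DFunLike.congr_fun hn l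
    simp [Finsupp.single_eq_of_ne' hil, hl] at this
  exact hjk ((hval j hj).symm.trans (hval k hk))

theorem IsMixedSum.ne_generator (hr : LinearIndependent ℕ r) (h : IsMixedSum r γ) (i : I) :
    γ ≠ r i := by
  simpa using h.add_ne_nsmul hr 0 1 i

theorem IsMixedSum.ne_neg_generator (hr : LinearIndependent ℕ r) (h : IsMixedSum r γ) (i : I) :
    γ ≠ -r i := by
  simpa [eq_neg_iff_add_eq_zero] using h.add_ne_nsmul hr (Finsupp.single i 1) 0 i

theorem ne_neg_of_linearIndependent (hr : LinearIndependent ℕ r) (i j : I) : r i ≠ -r j := by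
  intro h
  have : Finsupp.single i 1 + Finsupp.single j 1 = (0 : I →₀ ℕ) :=
    hr (by simp [h])
  simpa using DFunLike.congr_fun this i

end MixedSum

section Triangular

variable {I K A E : Type*} [Field K] [LieRing A] [LieAlgebra K A]
  [AddCommGroup E] [Module ℚ E] {h : Dual ℚ E → A} {r : I → E} {e f : I → A} {γ : E} {X : A}

/-- The part of weight `γ` of the Lie algebra generated by elements `e i` of weights `r i`, as far
as it is determined by the weights alone: the `e i` with `r i = γ`, and everything of weight `γ`
if `γ` is a mixed sum. -/
def nilpotentWeightSpace (K : Type*) {I A E : Type*} [Field K] [LieRing A] [LieAlgebra K A]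
    [AddCommGroup E] [Module ℚ E] (h : Dual ℚ E → A) (r : I → E) (e : I → A) (γ : E) :
    Submodule K A :=
  Submodule.span K {X | X ∈ adWeightSpace K h γ ∧ (IsMixedSum r γ ∨ ∃ i, γ = r i ∧ X = e i)}

theorem lieSpan_range_le [CharZero K] (he : ∀ i, e i ∈ adWeightSpace K h (r i)) :
    (LieSubalgebra.lieSpan K A (Set.range e)).toSubmodule ≤
      ⨆ γ, nilpotentWeightSpace K h r e γ := by
  have mem {γ : E} {X : A} (hX : X ∈ adWeightSpace K h γ)
      (hγ : IsMixedSum r γ ∨ ∃ i, γ = r i ∧ X = e i) :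
      X ∈ ⨆ γ, nilpotentWeightSpace K h r e γ :=
    Submodule.mem_iSup_of_mem γ (Submodule.subset_span ⟨hX, hγ⟩)
  refine lieSpan_le_of_forall_lie_mem ?_ ?_
  · rintro _ ⟨i, rfl⟩
    exact mem (he i) (.inr ⟨i, rfl, rfl⟩)
  rintro _ ⟨i, rfl⟩ Y hY
  suffices hle : ⨆ γ, nilpotentWeightSpace K h r e γ ≤
      (⨆ γ, nilpotentWeightSpace K h r e γ).comap (LieAlgebra.ad K A (e i)) from hle hY
  refine iSup_le fun γ => Submodule.span_le.2 ?_
  rintro X ⟨hX, hγ | ⟨j, rfl, rfl⟩⟩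
  · exact mem (lie_mem_adWeightSpace (he i) hX) (.inl (hγ.generator_add i))
  · obtain rfl | hij := eq_or_ne i j
    · simp
    · exact mem (lie_mem_adWeightSpace (he i) (he j)) (.inl (isMixedSum_add_of_ne hij))

theorem lie_mem_lieSpan_of_mem_span_range (he : ∀ i, e i ∈ adWeightSpace K h (r i)) :
    ∀ H ∈ Submodule.span K (Set.range h), ∀ X ∈ Set.range e,
      ⁅H, X⁆ ∈ LieSubalgebra.lieSpan K A (Set.range e) := by
  rintro H hH _ ⟨i, rfl⟩
  have hi : e i ∈ LieSubalgebra.lieSpan K A (Set.range e) :=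
    LieSubalgebra.subset_lieSpan (Set.mem_range_self i)
  induction hH using Submodule.span_induction with
  | mem H hH =>
    obtain ⟨φ, rfl⟩ := hH
    rw [mem_adWeightSpace.1 (he i)]
    exact LieSubalgebra.smul_mem _ _ hi
  | zero => simp
  | add H H' _ _ hH hH' => rw [add_lie]; exact add_mem hH hH'
  | smul c H _ hH => rw [smul_lie]; exact LieSubalgebra.smul_mem _ c hH

theorem span_range_le_adWeightSpace_zero (hh : ∀ φ ψ, ⁅h φ, h ψ⁆ = 0) :
    Submodule.span K (Set.range h) ≤ adWeightSpace K h 0 := by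
  rw [Submodule.span_le]
  rintro _ ⟨φ, rfl⟩
  exact mem_adWeightSpace.2 fun ψ => by simp [hh]

theorem nilpotentWeightSpace_le : nilpotentWeightSpace K h r e γ ≤ adWeightSpace K h γ :=
  Submodule.span_le.2 fun _ hX => hX.1

theorem mem_of_mem_lieSpan_of_mem_adWeightSpace [CharZero K] (hh : ∀ φ ψ, ⁅h φ, h ψ⁆ = 0)
    (he : ∀ i, e i ∈ adWeightSpace K h (r i)) (hf : ∀ i, f i ∈ adWeightSpace K h (-r i))
    (hef : ∀ i j, ⁅e i, f j⁆ ∈ Submodule.span K (Set.range h))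
    (hX : X ∈ LieSubalgebra.lieSpan K A (Set.range e ∪ Set.range f))
    (hγ : X ∈ adWeightSpace K h γ) (h0 : γ ≠ 0) :
    X ∈ nilpotentWeightSpace K h r e γ ⊔ nilpotentWeightSpace K h (-r) f γ := by
  set T : E → Submodule K A := fun δ =>
    nilpotentWeightSpace K h r e δ ⊔ nilpotentWeightSpace K h (-r) f δ ⊔
      ⨆ (_ : δ = 0), adWeightSpace K h 0 with hT
  have hTle : T ≤ adWeightSpace K h := fun δ =>
    sup_le (sup_le nilpotentWeightSpace_le nilpotentWeightSpace_le) (iSup_le fun h => h ▸ le_rfl)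
  have hle : (LieSubalgebra.lieSpan K A (Set.range e ∪ Set.range f)).toSubmodule ≤ ⨆ δ, T δ := by
    refine (lieSpan_union_le (by rintro _ ⟨i, rfl⟩ _ ⟨j, rfl⟩; exact hef i j)
      (lie_mem_lieSpan_of_mem_span_range he) (lie_mem_lieSpan_of_mem_span_range hf)).trans ?_
    refine sup_le (sup_le ?_ ?_) ?_
    · exact (lieSpan_range_le he).trans (iSup_mono fun δ => le_sup_left.trans le_sup_left)
    · exact (lieSpan_range_le hf).trans (iSup_mono fun δ => le_sup_right.trans le_sup_left)
    · refine (span_range_le_adWeightSpace_zero hh).trans (le_iSup_of_le 0 ?_)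
      simp [hT]
  have := inf_iSup_le_of_iSupIndep (iSupIndep_adWeightSpace hh) hTle γ ⟨hγ, hle hX⟩
  simpa [hT, h0] using this

theorem weight_cases_of_mem_lieSpan [CharZero K] (hh : ∀ φ ψ, ⁅h φ, h ψ⁆ = 0)
    (he : ∀ i, e i ∈ adWeightSpace K h (r i)) (hf : ∀ i, f i ∈ adWeightSpace K h (-r i))
    (hef : ∀ i j, ⁅e i, f j⁆ ∈ Submodule.span K (Set.range h))
    (hX : X ∈ LieSubalgebra.lieSpan K A (Set.range e ∪ Set.range f))
    (hγ : X ∈ adWeightSpace K h γ) (hX0 : X ≠ 0) :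
    γ = 0 ∨ (∃ i, γ = r i ∨ γ = -r i) ∨ IsMixedSum r γ ∨ IsMixedSum r (-γ) := by
  by_contra! hne
  obtain ⟨h0, hr, hpos, hneg⟩ := hne
  have hbot : nilpotentWeightSpace K h r e γ ⊔ nilpotentWeightSpace K h (-r) f γ = ⊥ := by
    simp [nilpotentWeightSpace, isMixedSum_neg_left, hpos, hneg, hr]
  have := mem_of_mem_lieSpan_of_mem_adWeightSpace hh he hf hef hX hγ h0
  exact hX0 (by simpa [hbot] using this)

theorem mem_span_of_mem_lieSpan [CharZero K] (hr : LinearIndependent ℕ r)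
    (hh : ∀ φ ψ, ⁅h φ, h ψ⁆ = 0) (he : ∀ i, e i ∈ adWeightSpace K h (r i))
    (hf : ∀ i, f i ∈ adWeightSpace K h (-r i))
    (hef : ∀ i j, ⁅e i, f j⁆ ∈ Submodule.span K (Set.range h)) (i : I)
    (hX : X ∈ LieSubalgebra.lieSpan K A (Set.range e ∪ Set.range f))
    (hi : X ∈ adWeightSpace K h (r i)) : X ∈ K ∙ e i := by
  have hpos : ¬IsMixedSum r (r i) := fun h => h.ne_generator hr i rfl
  have hneg : ¬IsMixedSum r (-r i) := fun h => h.ne_neg_generator hr i rfl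
  have hbot : nilpotentWeightSpace K h (-r) f (r i) = ⊥ := by
    simp [nilpotentWeightSpace, isMixedSum_neg_left, hneg, ne_neg_of_linearIndependent hr i]
  have h0 : r i ≠ 0 := hr.ne_zero i
  have hmem := mem_of_mem_lieSpan_of_mem_adWeightSpace hh he hf hef hX hi h0
  rw [hbot, sup_bot_eq] at hmem
  refine Submodule.span_mono ?_ hmem
  rintro _ ⟨-, hmixed | ⟨j, hij, rfl⟩⟩
  · exact absurd hmixed hpos
  · rw [hr.injective hij]
    rfl

end Triangular

section RootPairing

variable {ι E N : Type*} [AddCommGroup E] [Module ℚ E] [AddCommGroup N] [Module ℚ N]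
  {P : RootPairing ι ℚ E N}

theorem rootForm_self_mul_coroot' [Fintype ι] (i : ι) (v : E) :
    P.RootForm (P.root i) (P.root i) * P.coroot' i v = 2 * P.RootForm (P.root i) v := by
  have h := congrArg (P.toLinearMap v) (P.rootForm_self_smul_coroot i)
  rw [map_smul, map_nsmul, RootPairing.toLinearMap_apply_apply_Polarization, smul_eq_mul,
    nsmul_eq_mul] at h
  exact_mod_cast h

theorem rootForm_root_self_pos [Fintype ι] (i : ι) : 0 < P.RootForm (P.root i) (P.root i) :=
  P.rootForm_pos_of_ne_zero (Submodule.subset_span (Set.mem_range_self i)) (P.ne_zero i)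

theorem exists_coroot'_pos [Finite ι] {κ : Type*} (j : κ → ι) (n : κ →₀ ℕ)
    (h0 : Finsupp.linearCombination ℕ (P.root ∘ j) n ≠ 0) :
    ∃ k, n k ≠ 0 ∧ 0 < P.coroot' (j k) (Finsupp.linearCombination ℕ (P.root ∘ j) n) := by
  have := Fintype.ofFinite ι
  set γ := Finsupp.linearCombination ℕ (P.root ∘ j) n with hγ
  have hmem : γ ∈ P.rootSpan ℚ := by
    rw [hγ, Finsupp.linearCombination_apply]
    exact sum_mem fun k _ => nsmul_mem (Submodule.subset_span (Set.mem_range_self _)) _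
  have hform : P.RootForm γ γ = ∑ k ∈ n.support, n k * P.RootForm (P.root (j k)) γ := by
    nth_rewrite 1 [hγ]
    simp [Finsupp.linearCombination_apply, Finsupp.sum]
  have hsum := hform ▸ P.rootForm_pos_of_ne_zero hmem h0
  obtain ⟨k, hk, hpos⟩ := Finset.exists_lt_of_sum_lt (Finset.sum_const_zero.trans_lt hsum)
  refine ⟨k, Finsupp.mem_support_iff.1 hk, ?_⟩
  have hform_pos : 0 < P.RootForm (P.root (j k)) γ :=
    pos_of_mul_pos_right hpos (Nat.cast_nonneg (n k))
  refine pos_of_mul_pos_right ?_ (rootForm_root_self_pos (P := P) (j k)).le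
  rw [rootForm_self_mul_coroot']
  exact mul_pos two_pos hform_pos

theorem linearIndependent_nat_root (b : P.Base) :
    LinearIndependent ℕ fun i : b.support => P.root i :=
  LinearIndependent.restrict_scalars' ℕ b.linearIndepOn_root

variable [P.IsCrystallographic]

theorem exists_intCast_coroot'_eq {κ : Type*} (j : κ → ι) (n : κ →₀ ℕ) (i : ι) :
    ∃ m : ℤ, (m : ℚ) = P.coroot' i (Finsupp.linearCombination ℕ (P.root ∘ j) n) := by
  refine ⟨n.sum fun k c => c * P.pairingIn ℤ (j k) i, ?_⟩
  simp [Finsupp.linearCombination_apply, Finsupp.sum, ← P.algebraMap_pairingIn ℤ]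

variable [Finite ι]

theorem mem_range_root_of_isMixedSum (b : P.Base) {S : Set E}
    (hS : ∀ γ ∈ S, ∀ i ∈ b.support, P.reflection i γ ∈ S)
    (hcases : ∀ γ ∈ S, γ = 0 ∨ γ ∈ Set.range P.root ∨
      IsMixedSum (fun i : b.support => P.root i) γ ∨
      IsMixedSum (fun i : b.support => P.root i) (-γ))
    {γ : E} (hγ : γ ∈ S) (hmixed : IsMixedSum (fun i : b.support => P.root i) γ) :
    γ ∈ Set.range P.root := by
  have hr := linearIndependent_nat_root b
  obtain ⟨n, hne, hn⟩ := id hmixed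
  induction hd : n.degree using Nat.strong_induction_on generalizing γ n with | _ d ih
  have h0 : γ ≠ 0 := fun h => by
    simpa [h] using hmixed.add_ne_nsmul hr 0 0 hne.choose
  obtain ⟨i, -, hpos⟩ := exists_coroot'_pos (P := P) (fun i : b.support => (i : ι)) n (hn ▸ h0)
  obtain ⟨m, hm⟩ := exists_intCast_coroot'_eq (P := P) (fun i : b.support => (i : ι)) n i
  rw [← hm, Int.cast_pos] at hpos
  lift m to ℕ using hpos.le
  set δ := P.reflection i γ with hδ
  have hγδ : γ = δ + m • P.root i := by
    have hm' : P.coroot' i γ = m := by rw [← hn]; exact_mod_cast hm.symm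
    rw [hδ, P.reflection_apply, hm', Nat.cast_smul_eq_nsmul, sub_add_cancel]
  have hγ_root (h : δ ∈ Set.range P.root) : γ ∈ Set.range P.root := by
    simpa [hδ] using P.mapsTo_reflection_root i h
  obtain hδ0 | hδroot | hδpos | hδneg := hcases δ (hS γ hγ i i.2)
  · exact absurd (by simp [hγδ, hδ0]) (hmixed.add_ne_nsmul hr 0 m i)
  · exact hγ_root hδroot
  · obtain ⟨n', hne', hn'⟩ := id hδpos
    have hnn' : n' + Finsupp.single i m = n := hr (by simp [hn, hn', ← hγδ])
    refine hγ_root (ih n'.degree ?_ (hS γ hγ i i.2) hδpos n' hne' hn' rfl)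
    simpa [← hd, ← hnn'] using hpos
  · exact absurd (by simp [hn, hγδ]) (hδneg.add_ne_nsmul hr n m i)

theorem mem_range_root_of_forall_cases (b : P.Base) {S : Set E}
    (hS : ∀ γ ∈ S, ∀ i ∈ b.support, P.reflection i γ ∈ S)
    (hcases : ∀ γ ∈ S, γ = 0 ∨ γ ∈ Set.range P.root ∨
      IsMixedSum (fun i : b.support => P.root i) γ ∨
      IsMixedSum (fun i : b.support => P.root i) (-γ))
    {γ : E} (hγ : γ ∈ S) (h0 : γ ≠ 0) : γ ∈ Set.range P.root := by
  obtain h | h | h | h := hcases γ hγ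
  · exact absurd h h0
  · exact h
  · exact mem_range_root_of_isMixedSum b hS hcases hγ h
  · rw [← P.neg_mem_range_root_iff]
    refine mem_range_root_of_isMixedSum b (S := -S) (fun δ hδ i hi => ?_) (fun δ hδ => ?_)
      (Set.neg_mem_neg.2 hγ) h
    · simpa using hS (-δ) hδ i hi
    · have := hcases (-δ) hδ
      rw [neg_eq_zero, P.neg_mem_range_root_iff, neg_neg] at this
      tauto

end RootPairing

section BasisVec

variable {E V : Type*} [AddCommGroup V] [Module ℂ V] {Ψ : Set E}

theorem basisVec_of_mem (z : Basis Ψ ℂ V) {μ : E} (hμ : μ ∈ Ψ) : basisVec z μ = z ⟨μ, hμ⟩ :=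
  dif_pos hμ

theorem basisVec_of_notMem (z : Basis Ψ ℂ V) {μ : E} (hμ : μ ∉ Ψ) : basisVec z μ = 0 :=
  dif_neg hμ

theorem end_ext (z : Basis Ψ ℂ V) {X Y : End ℂ V}
    (h : ∀ μ ∈ Ψ, X (basisVec z μ) = Y (basisVec z μ)) : X = Y :=
  z.ext fun μ => by simpa [basisVec] using h μ μ.2

theorem basisVec_ne_zero (z : Basis Ψ ℂ V) {μ : E} (hμ : μ ∈ Ψ) : basisVec z μ ≠ 0 := by
  rw [basisVec_of_mem z hμ]
  exact z.ne_zero _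

end BasisVec

section Operators

variable {ι E N V : Type*} [AddCommGroup E] [Module ℚ E] [AddCommGroup N] [Module ℚ N]
  [AddCommGroup V] [Module ℂ V] {P : RootPairing ι ℚ E N} {Ψ : Set E} {z : Basis Ψ ℂ V}

/-- A set of weights that is stable under all reflections and consists of vectors pairing with
every coroot to `0`, `1` or `-1`, for instance a union of Weyl group orbits of minuscule weights. -/
structure IsMinusculeSet (P : RootPairing ι ℚ E N) (Ψ : Set E) : Prop where
  reflection_mem : ∀ μ ∈ Ψ, ∀ i, P.reflection i μ ∈ Ψ
  coroot'_mem : ∀ μ ∈ Ψ, ∀ i, P.coroot' i μ = 0 ∨ P.coroot' i μ = 1 ∨ P.coroot' i μ = -1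

theorem weylGroup_smul_coroot'_mem (g : P.weylGroup) {S : Set ℚ} {μ : E}
    (hμ : ∀ i, P.coroot' i μ ∈ S) (i : ι) : P.coroot' i (g • μ) ∈ S := by
  obtain ⟨g, hg⟩ := g
  induction hg using RootPairing.weylGroup.induction generalizing μ i with
  | mem j =>
    have h : (⟨RootPairing.Equiv.reflection P j, P.reflection_mem_weylGroup j⟩ : P.weylGroup) • μ =
      P.reflection j μ := RootPairing.weylGroup.ofIdx_smul P j μ
    rw [h, RootPairing.coroot'_reflection]
    exact hμ _
  | one => simpa using hμ i
  | mul x y hx hy ihx ihy =>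
    rw [← Submonoid.mk_mul_mk _ _ _ hx hy, mul_smul]
    exact ihx (fun j => ihy hμ j) i

theorem IsUnionOfMinusculeOrbits.isMinusculeSet {b : P.Base}
    (hΨ : IsUnionOfMinusculeOrbits b Ψ) : IsMinusculeSet P Ψ := by
  refine ⟨fun μ hμ i => hΨ.reflection_mem hμ i, fun μ hμ i => ?_⟩
  obtain ⟨-, S, hS, rfl⟩ := hΨ
  simp only [Set.mem_iUnion] at hμ
  obtain ⟨v, hv, g, rfl⟩ := hμ
  simpa using weylGroup_smul_coroot'_mem g (hS v hv).pairing_mem i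

theorem IsMinusculeSet.add_mem (hΨ : IsMinusculeSet P Ψ) {μ : E} (hμ : μ ∈ Ψ) {i : ι}
    (h : P.coroot' i μ = -1) : μ + P.root i ∈ Ψ := by
  simpa [RootPairing.reflection_apply, h] using hΨ.reflection_mem μ hμ i

theorem IsMinusculeSet.sub_mem (hΨ : IsMinusculeSet P Ψ) {μ : E} (hμ : μ ∈ Ψ) {i : ι}
    (h : P.coroot' i μ = 1) : μ - P.root i ∈ Ψ := by
  simpa [RootPairing.reflection_apply, h] using hΨ.reflection_mem μ hμ i

theorem IsMinusculeSet.abs_coroot'_le (hΨ : IsMinusculeSet P Ψ) {μ : E} (hμ : μ ∈ Ψ) (i : ι) :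
    |P.coroot' i μ| ≤ 1 := by
  obtain h | h | h := hΨ.coroot'_mem μ hμ i <;> simp [h]

theorem IsMinusculeSet.reflection_mem_iff (hΨ : IsMinusculeSet P Ψ) {μ : E} {i : ι} :
    P.reflection i μ ∈ Ψ ↔ μ ∈ Ψ :=
  ⟨fun h => by simpa using hΨ.reflection_mem _ h i, fun h => hΨ.reflection_mem _ h i⟩

theorem coroot'_root_self (i : ι) : P.coroot' i (P.root i) = 2 := by
  rw [RootPairing.root_coroot'_eq_pairing, RootPairing.pairing_same]

/-- The diagonal operator multiplying `z_μ` by `φ(μ)`. -/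
noncomputable def weightOp (z : Basis Ψ ℂ V) (φ : Dual ℚ E) : End ℂ V :=
  z.constr ℂ fun μ => (φ μ : ℂ) • z μ

theorem weightOp_apply (z : Basis Ψ ℂ V) (φ : Dual ℚ E) (μ : E) :
    weightOp z φ (basisVec z μ) = (φ μ : ℂ) • basisVec z μ := by
  by_cases hμ : μ ∈ Ψ
  · rw [basisVec_of_mem z hμ, weightOp, Basis.constr_basis]
  · rw [basisVec_of_notMem z hμ, map_zero, smul_zero]

theorem weightOp_lie_weightOp (φ ψ : Dual ℚ E) : ⁅weightOp z φ, weightOp z ψ⁆ = 0 := by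
  refine end_ext z fun μ _ => ?_
  simp [Ring.lie_def, weightOp_apply, smul_comm (φ μ : ℂ)]

theorem mem_adWeightSpace_weightOp {X : End ℂ V} {γ : E}
    (hX : ∀ μ ∈ Ψ, ∃ c : ℂ, X (basisVec z μ) = c • basisVec z (μ + γ)) :
    X ∈ adWeightSpace ℂ (weightOp z) γ := by
  refine mem_adWeightSpace.2 fun φ => end_ext z fun μ hμ => ?_
  obtain ⟨c, hc⟩ := hX μ hμ
  simp only [Ring.lie_def, LinearMap.sub_apply, Module.End.mul_apply, hc, map_smul, weightOp_apply,
    LinearMap.smul_apply, map_add, Rat.cast_add]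
  module

/-- Up to signs depending on the weight, the operator acts on the basis as `e_α` for the root
`α = P.root k`: `z_μ` goes to `± z_{μ + α}` if `(μ, α^∨) = -1`, and to `0` otherwise. -/
structure IsSignedShift (P : RootPairing ι ℚ E N) (z : Basis Ψ ℂ V) (k : ι) (X : End ℂ V) :
    Prop where
  apply_of_eq : ∀ μ ∈ Ψ, P.coroot' k μ = -1 →
    ∃ s : ℤˣ, X (basisVec z μ) = s • basisVec z (μ + P.root k)
  apply_of_ne : ∀ μ ∈ Ψ, P.coroot' k μ ≠ -1 → X (basisVec z μ) = 0

namespace IsSignedShift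

variable {i j k : ι} {X Y : End ℂ V}

theorem mem_adWeightSpace (hX : IsSignedShift P z k X) :
    X ∈ adWeightSpace ℂ (weightOp z) (P.root k) := by
  refine mem_adWeightSpace_weightOp fun μ hμ => ?_
  by_cases h : P.coroot' k μ = -1
  · obtain ⟨s, hs⟩ := hX.apply_of_eq μ hμ h
    exact ⟨((s : ℤ) : ℂ), by rw [hs, Units.smul_def, Int.cast_smul_eq_zsmul]⟩
  · exact ⟨0, by rw [hX.apply_of_ne μ hμ h, zero_smul]⟩

theorem eq_zero_of_forall_coroot'_eq_zero (hX : IsSignedShift P z k X)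
    (h : ∀ μ ∈ Ψ, P.coroot' k μ = 0) : X = 0 :=
  end_ext z fun μ hμ => hX.apply_of_ne μ hμ (by simp [h μ hμ])

theorem mul_apply_of_eq (hΨ : IsMinusculeSet P Ψ) (hX : IsSignedShift P z i X)
    (hY : IsSignedShift P z j Y) {μ : E} (hμ : μ ∈ Ψ) (hj : P.coroot' j μ = -1)
    (hi : P.coroot' i μ + P.pairing j i = -1) :
    ∃ s : ℤˣ, (X * Y) (basisVec z μ) = s • basisVec z (μ + (P.root i + P.root j)) := by
  obtain ⟨s, hs⟩ := hY.apply_of_eq μ hμ hj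
  obtain ⟨t, ht⟩ := hX.apply_of_eq _ (hΨ.add_mem hμ hj)
    (by rwa [map_add, RootPairing.root_coroot'_eq_pairing])
  refine ⟨s * t, ?_⟩
  rw [Module.End.mul_apply, hs, LinearMap.map_smul_of_tower, ht, smul_smul, add_assoc,
    add_comm (P.root j)]

theorem mul_apply_of_ne (hΨ : IsMinusculeSet P Ψ) (hX : IsSignedShift P z i X)
    (hY : IsSignedShift P z j Y) {μ : E} (hμ : μ ∈ Ψ)
    (h : P.coroot' j μ = -1 → P.coroot' i μ + P.pairing j i ≠ -1) :
    (X * Y) (basisVec z μ) = 0 := by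
  rw [Module.End.mul_apply]
  by_cases hj : P.coroot' j μ = -1
  · obtain ⟨s, hs⟩ := hY.apply_of_eq μ hμ hj
    rw [hs, LinearMap.map_smul_of_tower, hX.apply_of_ne _ (hΨ.add_mem hμ hj), smul_zero]
    rw [map_add, RootPairing.root_coroot'_eq_pairing]
    exact h hj
  · rw [hY.apply_of_ne μ hμ hj, map_zero]

theorem mul_eq_zero (hΨ : IsMinusculeSet P Ψ) (hX : IsSignedShift P z i X)
    (hY : IsSignedShift P z j Y) (hji : 0 < P.pairing j i) : X * Y = 0 := by
  refine end_ext z fun μ hμ => hX.mul_apply_of_ne hΨ hY hμ fun _ => ?_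
  have := abs_le.1 (hΨ.abs_coroot'_le hμ i)
  linarith

theorem exists_sign_of_eq_smul (hΨ : IsMinusculeSet P Ψ) (hX : IsSignedShift P z k X)
    (hY : IsSignedShift P z k Y) {c : ℂ} (hc : X = c • Y) : ∃ s : ℤˣ, X = s • Y := by
  by_cases h : ∃ μ ∈ Ψ, P.coroot' k μ = -1
  · obtain ⟨μ, hμ, hk⟩ := h
    obtain ⟨s, hs⟩ := hX.apply_of_eq μ hμ hk
    obtain ⟨t, ht⟩ := hY.apply_of_eq μ hμ hk
    have hv : t • basisVec z (μ + P.root k) ≠ 0 := by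
      rw [Ne, smul_eq_zero_iff_eq]
      exact basisVec_ne_zero z (hΨ.add_mem hμ hk)
    have hc' : c = ((s * t⁻¹ : ℤˣ) : ℤ) := smul_left_injective ℂ hv <| by
      dsimp only
      rw [Int.cast_smul_eq_zsmul, ← Units.smul_def, smul_smul (s * t⁻¹), inv_mul_cancel_right, ← hs,
        ← ht, hc, LinearMap.smul_apply]
    exact ⟨s * t⁻¹, by rw [hc, hc', Int.cast_smul_eq_zsmul, Units.smul_def]⟩
  · push Not at h
    refine ⟨1, end_ext z fun μ hμ => ?_⟩
    rw [one_smul, hX.apply_of_ne μ hμ (h μ hμ), hY.apply_of_ne μ hμ (h μ hμ)]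

end IsSignedShift

end Operators

section Generators

variable {ι E N V : Type*} [AddCommGroup E] [Module ℚ E] [AddCommGroup N] [Module ℚ N]
  [AddCommGroup V] [Module ℂ V] {P : RootPairing ι ℚ E N} {Ψ : Set E} {i j : ι} {μ : E}

theorem eOp_apply_of_eq (z : Basis Ψ ℂ V) (hμ : μ ∈ Ψ) (h : P.coroot' i μ = -1) :
    eOp P z i (basisVec z μ) = basisVec z (μ + P.root i) := by
  rw [basisVec_of_mem z hμ, eOp, Basis.constr_basis, if_pos h]

theorem eOp_apply_of_ne (z : Basis Ψ ℂ V) (hμ : μ ∈ Ψ) (h : P.coroot' i μ ≠ -1) :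
    eOp P z i (basisVec z μ) = 0 := by
  rw [basisVec_of_mem z hμ, eOp, Basis.constr_basis, if_neg h]

theorem fOp_apply_of_eq (z : Basis Ψ ℂ V) (hμ : μ ∈ Ψ) (h : P.coroot' i μ = 1) :
    fOp P z i (basisVec z μ) = basisVec z (μ - P.root i) := by
  rw [basisVec_of_mem z hμ, fOp, Basis.constr_basis, if_pos h]

theorem fOp_apply_of_ne (z : Basis Ψ ℂ V) (hμ : μ ∈ Ψ) (h : P.coroot' i μ ≠ 1) :
    fOp P z i (basisVec z μ) = 0 := by
  rw [basisVec_of_mem z hμ, fOp, Basis.constr_basis, if_neg h]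

theorem eOp_isSignedShift (z : Basis Ψ ℂ V) (i : ι) : IsSignedShift P z i (eOp P z i) :=
  ⟨fun _ hμ h => ⟨1, by rw [eOp_apply_of_eq z hμ h, one_smul]⟩,
    fun _ hμ h => eOp_apply_of_ne z hμ h⟩

theorem fOp_eq_eOp (z : Basis Ψ ℂ V) (i : ι) : fOp P z i = eOp P z (P.reflectionPerm i i) := by
  refine end_ext z fun μ hμ => ?_
  by_cases h : P.coroot' i μ = 1
  · rw [fOp_apply_of_eq z hμ h, eOp_apply_of_eq z hμ (by simpa using h)]
    simp [sub_eq_add_neg]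
  · rw [fOp_apply_of_ne z hμ h, eOp_apply_of_ne z hμ (by simpa using h)]

theorem eOp_lie_fOp_self (hΨ : IsMinusculeSet P Ψ) (z : Basis Ψ ℂ V) (i : ι) :
    ⁅eOp P z i, fOp P z i⁆ = weightOp z (P.coroot' i) := by
  refine end_ext z fun μ hμ => ?_
  rw [Ring.lie_def, LinearMap.sub_apply, Module.End.mul_apply, Module.End.mul_apply, weightOp_apply]
  obtain h | h | h := hΨ.coroot'_mem μ hμ i
  · rw [fOp_apply_of_ne z hμ (by rw [h]; norm_num), eOp_apply_of_ne z hμ (by rw [h]; norm_num), h]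
    simp
  · rw [fOp_apply_of_eq z hμ h, eOp_apply_of_ne z hμ (by rw [h]; norm_num),
      eOp_apply_of_eq z (hΨ.sub_mem hμ h) (by rw [map_sub, h, coroot'_root_self]; norm_num), h]
    simp
  · rw [eOp_apply_of_eq z hμ h, fOp_apply_of_ne z hμ (by rw [h]; norm_num),
      fOp_apply_of_eq z (hΨ.add_mem hμ h) (by rw [map_add, h, coroot'_root_self]; norm_num), h]
    simp

theorem eOp_mul_eOp_apply (hΨ : IsMinusculeSet P Ψ) (z : Basis Ψ ℂ V) (hji : P.pairing j i = 0)
    (hμ : μ ∈ Ψ) [Decidable (P.coroot' i μ = -1 ∧ P.coroot' j μ = -1)] :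
    (eOp P z i * eOp P z j) (basisVec z μ) =
      if P.coroot' i μ = -1 ∧ P.coroot' j μ = -1 then basisVec z (μ + (P.root i + P.root j))
      else 0 := by
  rw [Module.End.mul_apply]
  by_cases hj : P.coroot' j μ = -1
  · have hi : P.coroot' i (μ + P.root j) = P.coroot' i μ := by
      rw [map_add, RootPairing.root_coroot'_eq_pairing, hji, add_zero]
    rw [eOp_apply_of_eq z hμ hj]
    split_ifs with h
    · rw [eOp_apply_of_eq z (hΨ.add_mem hμ hj) (hi.trans h.1), add_assoc, add_comm (P.root j)]
    · exact eOp_apply_of_ne z (hΨ.add_mem hμ hj) fun h' => h ⟨hi ▸ h', hj⟩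
  · rw [eOp_apply_of_ne z hμ hj, map_zero, if_neg fun h => hj h.2]

theorem eOp_lie_eOp_of_pairing_nonneg (hΨ : IsMinusculeSet P Ψ) (z : Basis Ψ ℂ V)
    (hij : 0 ≤ P.pairing i j) (hji : 0 ≤ P.pairing j i) : ⁅eOp P z i, eOp P z j⁆ = 0 := by
  classical
  have hi := eOp_isSignedShift (P := P) z i
  have hj := eOp_isSignedShift (P := P) z j
  rw [Ring.lie_def]
  obtain h | h := hij.eq_or_lt
  · have h' : P.pairing j i = 0 := RootPairing.pairing_eq_zero_iff'.1 h.symm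
    refine end_ext z fun μ hμ => ?_
    rw [LinearMap.sub_apply, eOp_mul_eOp_apply hΨ z h' hμ, eOp_mul_eOp_apply hΨ z h.symm hμ,
      add_comm (P.root j), LinearMap.zero_apply, sub_eq_zero]
    exact if_congr and_comm rfl rfl
  · have h' : 0 < P.pairing j i :=
      hji.lt_of_ne' fun h' => h.ne' (RootPairing.pairing_eq_zero_iff'.1 h')
    rw [hi.mul_eq_zero hΨ hj h', hj.mul_eq_zero hΨ hi h, sub_zero]

theorem eOp_lie_fOp_mem_span [Finite ι] [P.IsCrystallographic] (hΨ : IsMinusculeSet P Ψ)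
    (b : P.Base) (z : Basis Ψ ℂ V) (i j : b.support) :
    ⁅eOp P z i, fOp P z j⁆ ∈ Submodule.span ℂ (Set.range (weightOp z)) := by
  by_cases hij : i = j
  · rw [hij, eOp_lie_fOp_self hΨ]
    exact Submodule.subset_span (Set.mem_range_self _)
  · have hpairing {k l : b.support} (hkl : k ≠ l) : P.pairing k l ≤ 0 := by
      rw [← P.algebraMap_pairingIn ℤ]
      exact Int.cast_nonpos.2 <| b.pairingIn_le_zero_of_ne (Subtype.coe_ne_coe.2 hkl) k.2 l.2
    rw [fOp_eq_eOp, eOp_lie_eOp_of_pairing_nonneg hΨ z]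
    · exact zero_mem _
    · simpa using hpairing hij
    · simpa using hpairing (Ne.symm hij)

theorem fOp_mem_adWeightSpace (z : Basis Ψ ℂ V) (i : ι) :
    fOp P z i ∈ adWeightSpace ℂ (weightOp z) (-P.root i) := by
  simpa [fOp_eq_eOp] using (eOp_isSignedShift (P := P) z (P.reflectionPerm i i)).mem_adWeightSpace

end Generators

section SignedReflection

variable {ι E N V : Type*} [AddCommGroup E] [Module ℚ E] [AddCommGroup N] [Module ℚ N]
  [AddCommGroup V] [Module ℂ V] {P : RootPairing ι ℚ E N} {Ψ : Set E} {z : Basis Ψ ℂ V} {i k : ι}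
  {g : LinearMap.GeneralLinearGroup ℂ V} {X : End ℂ V}

/-- The operator acts on the basis as the reflection `s_i` up to signs: it maps each `z_μ` to
`± z_{s_i(μ)}`. -/
def IsSignedReflection (P : RootPairing ι ℚ E N) (z : Basis Ψ ℂ V) (i : ι)
    (g : LinearMap.GeneralLinearGroup ℂ V) : Prop :=
  ∀ μ, ∃ s : ℤˣ, g.val (basisVec z μ) = s • basisVec z (P.reflection i μ)

theorem nOp_apply (v : V) :
    (nOp P z i).val v = (v + eOp P z i v) - fOp P z i (v + eOp P z i v) +
      eOp P z i ((v + eOp P z i v) - fOp P z i (v + eOp P z i v)) := by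
  simp [nOp, oneAddSmul, sub_eq_add_neg]

theorem nOp_isSignedReflection (hΨ : IsMinusculeSet P Ψ) (z : Basis Ψ ℂ V) (i : ι) :
    IsSignedReflection P z i (nOp P z i) := by
  intro μ
  by_cases hμ : μ ∈ Ψ
  · rw [nOp_apply, RootPairing.reflection_apply]
    obtain h | h | h := hΨ.coroot'_mem μ hμ i
    · refine ⟨1, ?_⟩
      simp [eOp_apply_of_ne z hμ (by rw [h]; norm_num), fOp_apply_of_ne z hμ (by rw [h]; norm_num),
        h]
    · refine ⟨-1, ?_⟩
      have hv : P.coroot' i (μ - P.root i) = -1 := by rw [map_sub, h, coroot'_root_self]; norm_num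
      rw [eOp_apply_of_ne z hμ (by rw [h]; norm_num), add_zero, fOp_apply_of_eq z hμ h, map_sub,
        eOp_apply_of_ne z hμ (by rw [h]; norm_num), eOp_apply_of_eq z (hΨ.sub_mem hμ h) hv,
        sub_add_cancel, h, one_smul, Units.neg_smul, one_smul]
      abel
    · refine ⟨1, ?_⟩
      have hp := hΨ.add_mem hμ h
      have hv : P.coroot' i (μ + P.root i) = 1 := by rw [map_add, h, coroot'_root_self]; norm_num
      simp [eOp_apply_of_eq z hμ h, fOp_apply_of_ne z hμ (by rw [h]; norm_num),
        fOp_apply_of_eq z hp hv, eOp_apply_of_ne z hp (by rw [hv]; norm_num), h]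
  · refine ⟨1, ?_⟩
    rw [basisVec_of_notMem z hμ, basisVec_of_notMem z (by rwa [hΨ.reflection_mem_iff]), map_zero,
      smul_zero]

namespace IsSignedReflection

theorem inv (hg : IsSignedReflection P z i g) : IsSignedReflection P z i g⁻¹ := by
  intro μ
  obtain ⟨s, h⟩ := hg (P.reflection i μ)
  refine ⟨s⁻¹, ?_⟩
  rw [RootPairing.reflection_same] at h
  rw [eq_inv_smul_iff, ← LinearMap.map_smul_of_tower, ← h, ← Module.End.mul_apply, Units.inv_mul,
    Module.End.one_apply]

theorem conj_weightOp (hg : IsSignedReflection P z i g) (φ : Dual ℚ E) :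
    ConjAct.toConjAct g • weightOp z φ = weightOp z (φ ∘ₗ (P.reflection i).toLinearMap) := by
  refine end_ext z fun μ _ => ?_
  obtain ⟨s, hs⟩ := hg.inv μ
  have hcancel : g.val (g⁻¹.val (basisVec z μ)) = basisVec z μ := by
    rw [← Module.End.mul_apply, Units.mul_inv, Module.End.one_apply]
  rw [ConjAct.units_smul_def, ConjAct.ofConjAct_toConjAct, Module.End.mul_apply,
    Module.End.mul_apply, hs, LinearMap.map_smul_of_tower, weightOp_apply, smul_comm, map_smul,
    ← hs, hcancel, weightOp_apply]
  rfl

theorem conj_mem_adWeightSpace (hg : IsSignedReflection P z i g) {γ : E}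
    (hX : X ∈ adWeightSpace ℂ (weightOp z) γ) :
    ConjAct.toConjAct g • X ∈ adWeightSpace ℂ (weightOp z) (P.reflection i γ) := by
  rw [mem_adWeightSpace] at hX ⊢
  intro φ
  have hφ : weightOp z φ =
      ConjAct.toConjAct g • weightOp z (φ ∘ₗ (P.reflection i).toLinearMap) := by
    rw [hg.conj_weightOp]
    congr 1
    ext v
    simp
  rw [hφ, Ring.lie_def, ← smul_mul', ← smul_mul', ← smul_sub, ← Ring.lie_def, hX, smul_comm]
  rfl

theorem conj_isSignedShift (hΨ : IsMinusculeSet P Ψ) (hg : IsSignedReflection P z i g)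
    (hX : IsSignedShift P z k X) :
    IsSignedShift P z (P.reflectionPerm i k) (ConjAct.toConjAct g • X) := by
  refine ⟨fun μ hμ h => ?_, fun μ hμ h => ?_⟩ <;>
    rw [RootPairing.coroot'_reflectionPerm] at h <;>
    obtain ⟨s, hs⟩ := hg.inv μ <;>
    rw [ConjAct.units_smul_def, ConjAct.ofConjAct_toConjAct, Module.End.mul_apply,
      Module.End.mul_apply, hs, LinearMap.map_smul_of_tower]
  · obtain ⟨t, ht⟩ := hX.apply_of_eq _ (hΨ.reflection_mem μ hμ i) h
    obtain ⟨u, hu⟩ := hg (P.reflection i μ + P.root k)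
    refine ⟨s * t * u, ?_⟩
    rw [ht, LinearMap.map_smul_of_tower, LinearMap.map_smul_of_tower, hu, map_add,
      RootPairing.reflection_same, RootPairing.root_reflectionPerm, smul_smul, smul_smul]
  · rw [hX.apply_of_ne _ (hΨ.reflection_mem μ hμ i) h, smul_zero, map_zero]

end IsSignedReflection

end SignedReflection

section RootLie

open Pointwise

variable {ι E N V : Type*} [AddCommGroup E] [Module ℚ E] [AddCommGroup N] [Module ℚ N]
  [AddCommGroup V] [Module ℂ V] {P : RootPairing ι ℚ E N} {Ψ : Set E} {b : P.Base}
  {z : Basis Ψ ℂ V} {γ δ : E} {X Y : End ℂ V}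

theorem lie_lie_of_mul_self_eq_zero (K : Type*) {A : Type*} [CommRing K] [Ring A] [Algebra K A]
    {a : A} (ha : a * a = 0) (x : A) : ⁅a, ⁅a, x⁆⁆ = (-2 : K) • (a * x * a) := by
  have h : a * (a * x) = 0 := by rw [← mul_assoc, ha, zero_mul]
  simp only [Ring.lie_def, mul_sub, sub_mul, mul_assoc, ha, h, mul_zero]
  module

theorem conj_oneAddSmul {a : End ℂ V} (ha : a * a = 0) (t : ℂ) (X : End ℂ V) :
    ConjAct.toConjAct (oneAddSmul a ha t) • X =
      X + t • ⁅a, X⁆ + (t ^ 2 / 2) • ⁅a, ⁅a, X⁆⁆ := by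
  rw [lie_lie_of_mul_self_eq_zero ℂ ha, Ring.lie_def]
  change (1 + t • a) * X * (1 - t • a) = _
  simp only [add_mul, mul_sub, one_mul, mul_one, smul_mul_assoc, mul_smul_comm]
  module

theorem conj_oneAddSmul_smul_eq (L : LieSubalgebra ℂ (End ℂ V)) {a : End ℂ V} (ha : a * a = 0)
    (haL : a ∈ L) (t : ℂ) :
    ConjAct.toConjAct (oneAddSmul a ha t) • L.toSubmodule = L.toSubmodule := by
  have hle (t : ℂ) : ConjAct.toConjAct (oneAddSmul a ha t) • L.toSubmodule ≤ L.toSubmodule := by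
    rintro _ ⟨X, hX, rfl⟩
    have haX := L.lie_mem haL hX
    rw [DistribSMul.toLinearMap_apply, conj_oneAddSmul]
    exact add_mem (add_mem hX (L.smul_mem _ haX)) (L.smul_mem _ (L.lie_mem haL haX))
  have hinv : (oneAddSmul a ha t)⁻¹ = oneAddSmul a ha (-t) := by
    ext1
    change 1 - t • a = 1 + (-t) • a
    rw [neg_smul, sub_eq_add_neg]
  refine (hle t).antisymm ?_
  rw [← smul_inv_smul (ConjAct.toConjAct (oneAddSmul a ha t)) L.toSubmodule]
  refine smul_mono_right _ ?_
  rw [smul_inv_smul, ← ConjAct.toConjAct_inv, hinv]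
  exact hle (-t)

/-- The Lie algebra generated by the operators `e_i` and `f_i`, for the simple indices `i`. -/
def rootLie (b : P.Base) (z : Basis Ψ ℂ V) : LieSubalgebra ℂ (End ℂ V) :=
  LieSubalgebra.lieSpan ℂ (End ℂ V)
    (Set.range (fun i : b.support => eOp P z i) ∪ Set.range fun i : b.support => fOp P z i)

theorem eOp_mem_rootLie (b : P.Base) (z : Basis Ψ ℂ V) (i : b.support) :
    eOp P z i ∈ rootLie b z :=
  LieSubalgebra.subset_lieSpan (Or.inl ⟨i, rfl⟩)

theorem fOp_mem_rootLie (b : P.Base) (z : Basis Ψ ℂ V) (i : b.support) :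
    fOp P z i ∈ rootLie b z :=
  LieSubalgebra.subset_lieSpan (Or.inr ⟨i, rfl⟩)

theorem conj_nOp_smul_rootLie (b : P.Base) (z : Basis Ψ ℂ V) (i : b.support) :
    ConjAct.toConjAct (nOp P z i) • (rootLie b z).toSubmodule = (rootLie b z).toSubmodule := by
  simp only [nOp, ConjAct.toConjAct_mul, mul_smul,
    conj_oneAddSmul_smul_eq _ (eOp_mul_self P z i) (eOp_mem_rootLie b z i),
    conj_oneAddSmul_smul_eq _ (fOp_mul_self P z i) (fOp_mem_rootLie b z i)]

/-- The weight space of weight `γ` in the Lie algebra generated by the operators `e_i` and `f_i`. -/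
noncomputable def lieWeightSpace (b : P.Base) (z : Basis Ψ ℂ V) (γ : E) : Submodule ℂ (End ℂ V) :=
  (rootLie b z).toSubmodule ⊓ adWeightSpace ℂ (weightOp z) γ

theorem lie_mem_lieWeightSpace (hX : X ∈ lieWeightSpace b z γ) (hY : Y ∈ lieWeightSpace b z δ) :
    ⁅X, Y⁆ ∈ lieWeightSpace b z (γ + δ) :=
  ⟨(rootLie b z).lie_mem hX.1 hY.1, lie_mem_adWeightSpace hX.2 hY.2⟩

theorem IsSignedReflection.conj_smul_lieWeightSpace_le {i : ι}
    {g : LinearMap.GeneralLinearGroup ℂ V} (hg : IsSignedReflection P z i g)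
    (hL : ConjAct.toConjAct g • (rootLie b z).toSubmodule = (rootLie b z).toSubmodule) (γ : E) :
    ConjAct.toConjAct g • lieWeightSpace b z γ ≤ lieWeightSpace b z (P.reflection i γ) := by
  rintro _ ⟨X, hX, rfl⟩
  exact ⟨hL.le (Submodule.smul_mem_pointwise_smul _ _ _ hX.1), hg.conj_mem_adWeightSpace hX.2⟩

theorem conj_nOp_smul_lieWeightSpace (hΨ : IsMinusculeSet P Ψ) (b : P.Base) (z : Basis Ψ ℂ V)
    (i : b.support) (γ : E) :
    ConjAct.toConjAct (nOp P z i) • lieWeightSpace b z γ =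
      lieWeightSpace b z (P.reflection i γ) := by
  have hn := nOp_isSignedReflection hΨ z (i : ι)
  have hL := conj_nOp_smul_rootLie b z i
  have hL' : ConjAct.toConjAct (nOp P z i)⁻¹ • (rootLie b z).toSubmodule =
      (rootLie b z).toSubmodule := by
    rw [ConjAct.toConjAct_inv, inv_smul_eq_iff, hL]
  have hle := hn.inv.conj_smul_lieWeightSpace_le hL' (P.reflection i γ)
  rw [RootPairing.reflection_same, ConjAct.toConjAct_inv] at hle
  refine (hn.conj_smul_lieWeightSpace_le hL γ).antisymm ?_
  rw [← smul_inv_smul (ConjAct.toConjAct (nOp P z i)) (lieWeightSpace b z (P.reflection i γ))]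
  exact smul_mono_right _ hle

/-- A spanning vector of the weight space of the root `P.root k`, normalised up to signs. -/
structure IsRootVector (b : P.Base) (z : Basis Ψ ℂ V) (k : ι) (X : End ℂ V) : Prop where
  mem : X ∈ lieWeightSpace b z (P.root k)
  isSignedShift : IsSignedShift P z k X
  lieWeightSpace_le : lieWeightSpace b z (P.root k) ≤ ℂ ∙ X

theorem IsRootVector.conj_nOp (hΨ : IsMinusculeSet P Ψ) {k : ι} (hX : IsRootVector b z k X)
    (j : b.support) :
    IsRootVector b z (P.reflectionPerm j k) (ConjAct.toConjAct (nOp P z j) • X) where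
  mem := by
    rw [RootPairing.root_reflectionPerm, ← conj_nOp_smul_lieWeightSpace hΨ]
    exact Submodule.smul_mem_pointwise_smul _ _ _ hX.mem
  isSignedShift := (nOp_isSignedReflection hΨ z (j : ι)).conj_isSignedShift hΨ hX.isSignedShift
  lieWeightSpace_le := by
    rw [RootPairing.root_reflectionPerm, ← conj_nOp_smul_lieWeightSpace hΨ,
      ← Set.smul_set_singleton, ← Submodule.smul_span]
    exact smul_mono_right _ hX.lieWeightSpace_le

section

variable [Finite ι] [P.IsCrystallographic]

theorem eOp_isRootVector (hΨ : IsMinusculeSet P Ψ) (b : P.Base) (z : Basis Ψ ℂ V) (i : b.support) :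
    IsRootVector b z i (eOp P z i) where
  mem := ⟨eOp_mem_rootLie b z i, (eOp_isSignedShift z _).mem_adWeightSpace⟩
  isSignedShift := eOp_isSignedShift z _
  lieWeightSpace_le _ hX :=
    mem_span_of_mem_lieSpan (linearIndependent_nat_root b) weightOp_lie_weightOp
      (fun _ => (eOp_isSignedShift z _).mem_adWeightSpace) (fun _ => fOp_mem_adWeightSpace z _)
      (eOp_lie_fOp_mem_span hΨ b z) i hX.1 hX.2

theorem mem_roots_of_mem_lieWeightSpace (hΨ : IsMinusculeSet P Ψ)
    (hX : X ∈ lieWeightSpace b z γ) (hX0 : X ≠ 0) (hγ : γ ≠ 0) : γ ∈ roots P := by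
  refine mem_range_root_of_forall_cases b (S := {γ | lieWeightSpace b z γ ≠ ⊥})
    (fun γ hγ i hi => ?_) (fun γ hγ => ?_) (Submodule.ne_bot_iff _ |>.2 ⟨X, hX, hX0⟩) hγ
  · rw [Set.mem_ofPred, ← conj_nOp_smul_lieWeightSpace hΨ b z ⟨i, hi⟩ γ]
    exact (smul_ne_zero_iff_ne _).2 hγ
  · obtain ⟨Y, hY, hY0⟩ := Submodule.ne_bot_iff _ |>.1 hγ
    obtain h | ⟨i, rfl | rfl⟩ | h | h := weight_cases_of_mem_lieSpan weightOp_lie_weightOp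
      (fun _ => (eOp_isSignedShift z _).mem_adWeightSpace) (fun _ => fOp_mem_adWeightSpace z _)
      (eOp_lie_fOp_mem_span hΨ b z) hY.1 hY.2 hY0
    all_goals simp_all

theorem isRootVector_conj_list_prod (hΨ : IsMinusculeSet P Ψ) (b : P.Base) (z : Basis Ψ ℂ V)
    (i : b.support) (l : List b.support) :
    ∃ k, P.root k = (l.map fun j : b.support => P.reflection j.1).prod (P.root i) ∧
      IsRootVector b z k
        (ConjAct.toConjAct (l.map fun j : b.support => nOp P z j.1).prod • eOp P z i) := by
  induction l with
  | nil => exact ⟨i, by simp, by simpa using eOp_isRootVector hΨ b z i⟩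
  | cons j l ih =>
    obtain ⟨k, hk, hX⟩ := ih
    refine ⟨P.reflectionPerm j k, ?_, ?_⟩
    · rw [RootPairing.root_reflectionPerm, hk, List.map_cons, List.prod_cons]
      rfl
    · rw [List.map_cons, List.prod_cons, ConjAct.toConjAct_mul, mul_smul]
      exact hX.conj_nOp hΨ j

theorem IsRootVectorChoice.isRootVector (hΨ : IsMinusculeSet P Ψ) {e : E → End ℂ V}
    (he : IsRootVectorChoice b z e) (k : ι) : IsRootVector b z k (e (P.root k)) := by
  obtain ⟨i, l, hk, hek⟩ := he (P.root k) (Set.mem_range_self k)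
  obtain ⟨m, hm, hX⟩ := isRootVector_conj_list_prod hΨ b z i l
  rw [hek, P.root.injective (hk.trans hm.symm)]
  exact hX

end

end RootLie

section RankTwo

variable {ι E N : Type*} [AddCommGroup E] [Module ℚ E] [AddCommGroup N] [Module ℚ N]
  {P : RootPairing ι ℚ E N} {Ψ : Set E} {i j k : ι}

theorem root_reflectionPerm_eq (i j : ι) :
    P.root (P.reflectionPerm i j) = P.root j - P.pairing j i • P.root i := by
  rw [RootPairing.root_reflectionPerm, RootPairing.reflection_apply_root]

theorem coroot'_reflectionPerm_apply (i j : ι) (v : E) :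
    P.coroot' (P.reflectionPerm i j) v = P.coroot' j v - P.pairing i j * P.coroot' i v := by
  rw [RootPairing.coroot'_reflectionPerm, LinearMap.comp_apply, LinearEquiv.coe_coe,
    RootPairing.reflection_apply, map_sub, map_smul, RootPairing.root_coroot'_eq_pairing,
    smul_eq_mul, mul_comm]

theorem pairing_eq_add_of_root_eq {a : ℚ} (hk : P.root k = P.root i + a • P.root j) :
    P.pairing k j = P.pairing i j + a * 2 := by
  rw [← RootPairing.root_coroot'_eq_pairing, hk, map_add, map_smul, coroot'_root_self,
    RootPairing.root_coroot'_eq_pairing, smul_eq_mul]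

section Crystallographic

variable [P.IsCrystallographic]

theorem exists_intCast_eq_pairing (i j : ι) : ∃ n : ℤ, P.pairing i j = n :=
  ⟨P.pairingIn ℤ i j, (P.algebraMap_pairingIn ℤ i j).symm⟩

variable [Finite ι]

theorem root_add_root_mem_of_pairing_neg (h : P.pairing i j < 0) (hne : P.root i ≠ -P.root j) :
    P.root i + P.root j ∈ roots P := by
  rw [← P.algebraMap_pairingIn ℤ] at h
  exact P.root_add_root_mem_of_pairingIn_neg (Int.cast_lt_zero.1 h) hne

theorem root_sub_root_mem_of_pairing_pos (h : 0 < P.pairing i j) (hne : i ≠ j) :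
    P.root i - P.root j ∈ roots P := by
  rw [← P.algebraMap_pairingIn ℤ] at h
  exact P.root_sub_root_mem_of_pairingIn_pos (Int.cast_pos.1 h) hne

theorem pairing_eq_neg_one_or_of_neg (h : P.pairing i j < 0) (hne : P.root i ≠ -P.root j) :
    P.pairing i j = -1 ∨ P.pairing j i = -1 := by
  have hneg := mt (P.pairing_neg_two_neg_two_iff i j).1 hne
  have hmem := P.pairingIn_pairingIn_mem_set_of_isCrystallographic i j
  simp only [Set.mem_insert_iff, Set.mem_singleton_iff, Prod.mk.injEq] at hmem
  simp only [← P.algebraMap_pairingIn ℤ, algebraMap_int_eq, eq_intCast] at h hneg ⊢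
  norm_cast at h hneg ⊢
  omega

end Crystallographic

theorem coroot'_eq_zero_of_three_le_abs_pairing (hΨ : IsMinusculeSet P Ψ)
    (h : 3 ≤ |P.pairing i j|) {μ : E} (hμ : μ ∈ Ψ) : P.coroot' i μ = 0 ∧ P.coroot' j μ = 0 := by
  have hi {ν : E} (hν : ν ∈ Ψ) : P.coroot' i ν = 0 := by
    by_contra h0
    have h1 : |P.coroot' i ν| = 1 := by
      rw [abs_eq zero_le_one]
      exact (hΨ.coroot'_mem ν hν i).resolve_left h0
    have hk := hΨ.abs_coroot'_le hν (P.reflectionPerm i j)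
    rw [coroot'_reflectionPerm_apply, abs_sub_comm] at hk
    have hij := (abs_sub_abs_le_abs_sub _ _).trans hk
    rw [abs_mul, h1, mul_one] at hij
    have hj := hΨ.abs_coroot'_le hν j
    linarith
  refine ⟨hi hμ, ?_⟩
  have hs := hi (hΨ.reflection_mem μ hμ j)
  rw [RootPairing.reflection_apply, map_sub, map_smul, hi hμ, zero_sub, neg_eq_zero, smul_eq_mul,
    RootPairing.root_coroot'_eq_pairing] at hs
  refine (mul_eq_zero.1 hs).resolve_right fun hji => ?_
  rw [RootPairing.pairing_eq_zero_iff'.1 hji] at h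
  norm_num at h

theorem coroot'_eq_zero_of_mem_span [Finite ι] {μ : E} (hi : P.coroot' i μ = 0)
    (hj : P.coroot' j μ = 0) (hk : P.root k ∈ Submodule.span ℚ {P.root i, P.root j}) :
    P.coroot' k μ = 0 := by
  have := Fintype.ofFinite ι
  have hform {m : ι} (hm : P.coroot' m μ = 0) : P.RootForm (P.root m) μ = 0 := by
    simpa [hm] using (rootForm_self_mul_coroot' (P := P) m μ).symm
  obtain ⟨a, c, hac⟩ := Submodule.mem_span_pair.1 hk
  have hkμ := rootForm_self_mul_coroot' (P := P) k μ
  nth_rw 3 [← hac] at hkμ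
  rw [map_add, map_smul, map_smul, LinearMap.add_apply, LinearMap.smul_apply,
    LinearMap.smul_apply, hform hi, hform hj, smul_zero, smul_zero, add_zero, mul_zero] at hkμ
  exact (mul_eq_zero.1 hkμ).resolve_left (rootForm_root_self_pos k).ne'

end RankTwo

section Products

variable {ι E N V : Type*} [AddCommGroup E] [Module ℚ E] [AddCommGroup N] [Module ℚ N]
  [AddCommGroup V] [Module ℂ V] {P : RootPairing ι ℚ E N} {Ψ : Set E} {z : Basis Ψ ℂ V}
  {i j k : ι} {X Y : End ℂ V}

namespace IsSignedShift

theorem eq_zero_of_mem_span [Finite ι] (hΨ : IsMinusculeSet P Ψ) (hX : IsSignedShift P z k X)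
    (h : 3 ≤ |P.pairing i j|) (hk : P.root k ∈ Submodule.span ℚ {P.root i, P.root j}) : X = 0 :=
  hX.eq_zero_of_forall_coroot'_eq_zero fun _ hμ =>
    have h0 := coroot'_eq_zero_of_three_le_abs_pairing hΨ h hμ
    coroot'_eq_zero_of_mem_span h0.1 h0.2 hk

theorem mul_self_eq_zero (hΨ : IsMinusculeSet P Ψ) (hX : IsSignedShift P z i X) : X * X = 0 :=
  hX.mul_eq_zero hΨ hX (by rw [RootPairing.pairing_same]; exact two_pos)

theorem mul_mul_eq_zero (hΨ : IsMinusculeSet P Ψ) (hX : IsSignedShift P z i X)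
    (hY : IsSignedShift P z j Y) (hij : P.pairing i j ≠ -2) : Y * X * Y = 0 := by
  refine end_ext z fun μ hμ => ?_
  rw [Module.End.mul_apply, LinearMap.zero_apply]
  by_cases hj : P.coroot' j μ = -1
  · obtain ⟨s, hs⟩ := hY.apply_of_eq μ hμ hj
    rw [hs, LinearMap.map_smul_of_tower, hY.mul_apply_of_ne hΨ hX (hΨ.add_mem hμ hj), smul_zero]
    rw [map_add (P.coroot' j), coroot'_root_self, hj]
    exact fun _ h => hij (by linarith)
  · rw [hY.apply_of_ne μ hμ hj, map_zero]

theorem lie (hΨ : IsMinusculeSet P Ψ) (hX : IsSignedShift P z i X) (hY : IsSignedShift P z j Y)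
    (hij : P.pairing i j < 0) (hji : P.pairing j i = -1) :
    IsSignedShift P z (P.reflectionPerm i j) ⁅X, Y⁆ := by
  have hroot : P.root (P.reflectionPerm i j) = P.root i + P.root j := by
    rw [root_reflectionPerm_eq, hji]
    module
  refine ⟨fun μ hμ hk => ?_, fun μ hμ hk => ?_⟩ <;>
    rw [coroot'_reflectionPerm_apply] at hk <;>
    rw [Ring.lie_def, LinearMap.sub_apply]
  · rw [hroot]
    obtain hi | hi | hi := hΨ.coroot'_mem μ hμ i <;> rw [hi] at hk
    · obtain ⟨s, hs⟩ := hX.mul_apply_of_eq hΨ hY hμ (by linarith) (by rw [hi, hji, zero_add])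
      refine ⟨s, ?_⟩
      rw [hs, hY.mul_apply_of_ne hΨ hX hμ (by norm_num [hi]), sub_zero]
    · have := abs_le.1 (hΨ.abs_coroot'_le hμ j)
      linarith
    · obtain ⟨s, hs⟩ := hY.mul_apply_of_eq hΨ hX hμ hi (by linarith)
      refine ⟨-s, ?_⟩
      rw [hs, hX.mul_apply_of_ne hΨ hY hμ fun hj => by linarith, zero_sub, Units.neg_smul,
        add_comm (P.root i)]
  · rw [hX.mul_apply_of_ne hΨ hY hμ, hY.mul_apply_of_ne hΨ hX hμ, sub_zero]
    · exact fun hi hj => hk (by rw [hi]; linarith)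
    · intro hj hi
      have hi' : P.coroot' i μ = 0 := by linarith
      exact hk (by rw [hi', hj, mul_zero, sub_zero])

theorem mul_mul (hΨ : IsMinusculeSet P Ψ) (hX : IsSignedShift P z i X)
    (hY : IsSignedShift P z j Y) (hij : P.pairing i j = -2) (hji : P.pairing j i = -1) :
    IsSignedShift P z (P.reflectionPerm j i) (Y * X * Y) := by
  have hroot : P.root (P.reflectionPerm j i) = P.root j + (P.root j + P.root i) := by
    rw [root_reflectionPerm_eq, hij]
    module
  refine ⟨fun μ hμ hk => ?_, fun μ hμ hk => ?_⟩ <;>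
    rw [coroot'_reflectionPerm_apply, hji] at hk <;>
    rw [Module.End.mul_apply]
  · have hi : P.coroot' i μ ≠ -1 := fun hi => by
      -- otherwise `μ + α_i` would pair to `-2` with the coroot of `α_j`
      have := abs_le.1 (hΨ.abs_coroot'_le (hΨ.add_mem hμ hi) j)
      rw [map_add, RootPairing.root_coroot'_eq_pairing, hij] at this
      linarith
    have hi' := (hΨ.coroot'_mem μ hμ i).resolve_right fun h => h.elim (fun h => by
      have := abs_le.1 (hΨ.abs_coroot'_le hμ j)
      linarith) hi
    have hj : P.coroot' j μ = -1 := by linarith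
    obtain ⟨s, hs⟩ := hY.apply_of_eq μ hμ hj
    obtain ⟨t, ht⟩ := hY.mul_apply_of_eq hΨ hX (hΨ.add_mem hμ hj)
      (by rw [map_add, hi', RootPairing.root_coroot'_eq_pairing, hji, zero_add])
      (by rw [map_add, hj, coroot'_root_self, hij]; norm_num)
    refine ⟨s * t, ?_⟩
    rw [hs, LinearMap.map_smul_of_tower, ht, smul_smul, hroot, add_assoc]
  · by_cases hj : P.coroot' j μ = -1
    · obtain ⟨s, hs⟩ := hY.apply_of_eq μ hμ hj
      rw [hs, LinearMap.map_smul_of_tower, hY.mul_apply_of_ne hΨ hX (hΨ.add_mem hμ hj),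
        smul_zero]
      rw [map_add, RootPairing.root_coroot'_eq_pairing, hji]
      exact fun hi => absurd (by linarith) hk
    · rw [hY.apply_of_ne μ hμ hj, map_zero]

end IsSignedShift

theorem mul_eq_zero_of_mem_brackets {R : Type*} [Ring R] {x y : R} (hxx : x * x = 0)
    (hyy : y * y = 0) (hxyx : x * y * x = 0) :
    ∀ u ∈ ({x, ⁅x, y⁆, y * x * y} : Set R), ∀ v ∈ ({x, ⁅x, y⁆, y * x * y} : Set R),
      u * v = 0 := by
  have hxx' (w : R) : x * (x * w) = 0 := by rw [← mul_assoc, hxx, zero_mul]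
  have hyy' (w : R) : y * (y * w) = 0 := by rw [← mul_assoc, hyy, zero_mul]
  have hxyx' (w : R) : x * (y * (x * w)) = 0 := by rw [← mul_assoc, ← mul_assoc, hxyx, zero_mul]
  rw [mul_assoc] at hxyx
  simp only [Set.mem_insert_iff, Set.mem_singleton_iff]
  rintro u (rfl | rfl | rfl) v (rfl | rfl | rfl) <;>
    simp only [Ring.lie_def, mul_sub, sub_mul, mul_assoc, hxx, hxyx, hxx', hyy', hxyx', mul_zero,
      sub_zero]

end Products

section Relations

variable {ι E N V : Type*} [AddCommGroup E] [Module ℚ E] [AddCommGroup N] [Module ℚ N]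
  [AddCommGroup V] [Module ℂ V] {P : RootPairing ι ℚ E N} {Ψ : Set E} {b : P.Base}
  {z : Basis Ψ ℂ V} {i j k l : ι} {T W X Y Z : End ℂ V}

namespace IsRootVector

theorem mul_mul_mem (hΨ : IsMinusculeSet P Ψ) (hX : IsRootVector b z i X)
    (hY : IsRootVector b z j Y) :
    Y * X * Y ∈ lieWeightSpace b z (P.root j + (P.root j + P.root i)) := by
  have hYXY : Y * X * Y = (-1 / 2 : ℂ) • ⁅Y, ⁅Y, X⁆⁆ := by
    rw [lie_lie_of_mul_self_eq_zero ℂ (hY.isSignedShift.mul_self_eq_zero hΨ)]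
    module
  rw [hYXY]
  have hYX := lie_mem_lieWeightSpace hY.mem hX.mem
  exact Submodule.smul_mem _ _ (lie_mem_lieWeightSpace hY.mem hYX)

theorem exists_eq_sign_smul (hΨ : IsMinusculeSet P Ψ) (hZ : IsRootVector b z k Z)
    (hW : W ∈ lieWeightSpace b z (P.root k)) (hWs : IsSignedShift P z k W) :
    ∃ s : ℤˣ, W = s • Z := by
  obtain ⟨c, hc⟩ := Submodule.mem_span_singleton.1 (hZ.lieWeightSpace_le hW)
  exact hWs.exists_sign_of_eq_smul hΨ hZ.isSignedShift hc.symm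

theorem lie_eq_sign_smul_of_pairing_eq_neg_one (hΨ : IsMinusculeSet P Ψ)
    (hX : IsRootVector b z i X) (hY : IsRootVector b z j Y) (hZ : IsRootVector b z k Z)
    (hk : P.root k = P.root i + P.root j) (hij : P.pairing i j < 0) (hji : P.pairing j i = -1) :
    ∃ s : ℤˣ, ⁅X, Y⁆ = s • Z := by
  refine hZ.exists_eq_sign_smul hΨ (hk ▸ lie_mem_lieWeightSpace hX.mem hY.mem) ?_
  have hkij : k = P.reflectionPerm i j := P.root.injective <| by
    rw [hk, root_reflectionPerm_eq, hji]
    module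
  exact hkij ▸ hX.isSignedShift.lie hΨ hY.isSignedShift hij hji

theorem mul_mul_eq_zero (hΨ : IsMinusculeSet P Ψ) (hX : IsRootVector b z i X)
    (hY : IsRootVector b z j Y) (h : P.root i + (2 : ℚ) • P.root j ∉ roots P) :
    Y * X * Y = 0 := by
  refine hX.isSignedShift.mul_mul_eq_zero hΨ hY.isSignedShift fun hij => h ?_
  refine ⟨P.reflectionPerm j i, ?_⟩
  rw [root_reflectionPerm_eq, hij]
  module

variable [Finite ι] [P.IsCrystallographic]

theorem lie_eq_zero (hΨ : IsMinusculeSet P Ψ) (hX : IsRootVector b z i X)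
    (hY : IsRootVector b z j Y) (hne : P.root i ≠ -P.root j)
    (h : P.root i + P.root j ∉ roots P) : ⁅X, Y⁆ = 0 :=
  of_not_not fun h0 => h <| mem_roots_of_mem_lieWeightSpace hΨ
    (lie_mem_lieWeightSpace hX.mem hY.mem) h0 fun h' => hne (eq_neg_of_add_eq_zero_left h')

theorem lie_eq_sign_smul_of_pairing_neg (hΨ : IsMinusculeSet P Ψ) (hX : IsRootVector b z i X)
    (hY : IsRootVector b z j Y) (hZ : IsRootVector b z k Z)
    (hk : P.root k = P.root i + P.root j) (hne : P.root i ≠ -P.root j) (hij : P.pairing i j < 0) :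
    ∃ s : ℤˣ, ⁅X, Y⁆ = s • Z := by
  obtain h | h := (pairing_eq_neg_one_or_of_neg hij hne).symm
  · exact hX.lie_eq_sign_smul_of_pairing_eq_neg_one hΨ hY hZ hk hij h
  · have hji : P.pairing j i < 0 := by
      rw [← P.algebraMap_pairingIn ℤ] at hij ⊢
      exact Int.cast_lt_zero.2 ((P.pairingIn_lt_zero_iff ℤ).1 (Int.cast_lt_zero.1 hij))
    obtain ⟨s, hs⟩ := hY.lie_eq_sign_smul_of_pairing_eq_neg_one hΨ hX hZ
      (hk.trans (add_comm _ _)) hji h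
    exact ⟨-s, by rw [← lie_skew, hs, Units.neg_smul]⟩

theorem lie_eq_sign_smul (hΨ : IsMinusculeSet P Ψ) (hX : IsRootVector b z i X)
    (hY : IsRootVector b z j Y) (hZ : IsRootVector b z k Z)
    (hk : P.root k = P.root i + P.root j) (hne : i ≠ j) (hne' : P.root i ≠ -P.root j)
    (hsub : P.root i - P.root j ∉ roots P) : ∃ s : ℤˣ, ⁅X, Y⁆ = s • Z := by
  refine hX.lie_eq_sign_smul_of_pairing_neg hΨ hY hZ hk hne' (lt_of_le_of_ne ?_ fun hij => hsub ?_)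
  · exact not_lt.1 fun hij => hsub (root_sub_root_mem_of_pairing_pos hij hne)
  · refine ⟨P.reflectionPerm j k, ?_⟩
    have hkj : P.pairing k j = P.pairing i j + 1 * 2 :=
      pairing_eq_add_of_root_eq (by rw [hk, one_smul])
    rw [root_reflectionPerm_eq, hkj, hij, hk]
    module

theorem mul_mul_eq_sign_smul (hΨ : IsMinusculeSet P Ψ) (hX : IsRootVector b z i X)
    (hY : IsRootVector b z j Y) (hZ : IsRootVector b z k Z)
    (hk : P.root k = P.root i + (2 : ℚ) • P.root j) (hne : P.root i ≠ -P.root j) :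
    ∃ s : ℤˣ, Y * X * Y = s • Z := by
  by_cases hij : P.pairing i j = -2
  · have hji : P.pairing j i = -1 :=
      (pairing_eq_neg_one_or_of_neg (by linarith) hne).resolve_left (by norm_num [hij])
    have hkij : k = P.reflectionPerm j i := P.root.injective <| by
      rw [hk, root_reflectionPerm_eq, hij]
      module
    refine hZ.exists_eq_sign_smul hΨ ?_ ?_
    · rw [hk, show P.root i + (2 : ℚ) • P.root j = P.root j + (P.root j + P.root i) by module]
      exact hX.mul_mul_mem hΨ hY
    · exact hkij ▸ hX.isSignedShift.mul_mul hΨ hY.isSignedShift hij hji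
  · have hZ0 : Z = 0 := by
      obtain ⟨p, hp⟩ := exists_intCast_eq_pairing i j (P := P)
      have hkj := pairing_eq_add_of_root_eq hk
      rw [hp] at hij hkj
      norm_cast at hij
      obtain h | h : p ≤ -3 ∨ -1 ≤ p := by omega
      · refine hZ.isSignedShift.eq_zero_of_mem_span (i := i) (j := j) hΨ (le_abs'.2 (Or.inl ?_)) ?_
        · rw [hp]
          exact_mod_cast h
        · exact Submodule.mem_span_pair.2 ⟨1, 2, by rw [hk, one_smul]⟩
      · refine hZ.isSignedShift.eq_zero_of_mem_span (i := k) (j := j) hΨ (le_abs.2 (Or.inl ?_)) ?_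
        · rw [hkj]
          norm_cast
          omega
        · exact Submodule.subset_span (by simp)
    refine ⟨1, ?_⟩
    rw [hX.isSignedShift.mul_mul_eq_zero hΨ hY.isSignedShift hij, hZ0, smul_zero]

theorem eq_zero_and_eq_zero_of_pairing_ne_zero (hΨ : IsMinusculeSet P Ψ)
    (hY : IsRootVector b z j Y) (hZ : IsRootVector b z k Z) (hk : P.root k = P.root i + P.root j)
    (hl : P.root l = P.root i - P.root j) (hij : P.pairing i j ≠ 0) : Y = 0 ∧ Z = 0 := by
  have hkj : P.pairing k j = P.pairing i j + 1 * 2 :=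
    pairing_eq_add_of_root_eq (by rw [hk, one_smul])
  have hlj : P.pairing l j = P.pairing i j + -1 * 2 :=
    pairing_eq_add_of_root_eq (by rw [hl, neg_one_smul, sub_eq_add_neg])
  obtain ⟨m, hm, hkm⟩ : ∃ m, 3 ≤ |P.pairing m j| ∧
      P.root k ∈ Submodule.span ℚ {P.root m, P.root j} := by
    obtain ⟨p, hp⟩ := exists_intCast_eq_pairing i j (P := P)
    rw [hp] at hij hkj hlj
    norm_cast at hij
    obtain h | h : 1 ≤ p ∨ p ≤ -1 := by omega
    · refine ⟨k, le_abs.2 (Or.inl ?_), Submodule.subset_span (by simp)⟩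
      rw [hkj]
      norm_cast
      omega
    · refine ⟨l, le_abs'.2 (Or.inl ?_), Submodule.mem_span_pair.2 ⟨1, 2, ?_⟩⟩
      · rw [hlj]
        norm_cast
        omega
      · rw [hl, hk]
        module
  exact ⟨hY.isSignedShift.eq_zero_of_mem_span hΨ hm (Submodule.subset_span (by simp)),
    hZ.isSignedShift.eq_zero_of_mem_span hΨ hm hkm⟩

theorem lie_eq_two_sign_smul (hΨ : IsMinusculeSet P Ψ) (hX : IsRootVector b z i X)
    (hY : IsRootVector b z j Y) (hZ : IsRootVector b z k Z) (hT : IsRootVector b z l T)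
    (hk : P.root k = P.root i + P.root j) (hl : P.root l = P.root i - P.root j) :
    ∃ s : ℤˣ, ⁅X, Y⁆ = s • (2 : ℂ) • Z := by
  by_cases hij : P.pairing i j = 0
  · have hi : P.root i = P.root l + P.root j := by rw [hl, sub_add_cancel]
    have hne : P.root l ≠ -P.root j := fun h => P.ne_zero i (by rw [hi, h, neg_add_cancel])
    have hlj : P.pairing l j < 0 := by
      rw [pairing_eq_add_of_root_eq (i := i) (a := -1) (by rw [hl]; module), hij]
      norm_num
    have hk' : P.root k = P.root l + (2 : ℚ) • P.root j := by
      rw [hk, hi]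
      module
    obtain ⟨s, hs⟩ := hT.lie_eq_sign_smul_of_pairing_neg hΨ hY hX hi hne hlj
    obtain ⟨t, ht⟩ := hT.mul_mul_eq_sign_smul hΨ hY hZ hk' hne
    refine ⟨-(s * t), ?_⟩
    have hX' : X = s • ⁅T, Y⁆ := by rw [hs, smul_smul, Int.units_mul_self, one_smul]
    calc ⁅X, Y⁆ = s • ⁅⁅T, Y⁆, Y⁆ := by rw [hX', Units.smul_def, smul_lie, Units.smul_def]
      _ = s • ⁅Y, ⁅Y, T⁆⁆ := by rw [← lie_skew, ← lie_skew T, lie_neg, neg_neg]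
      _ = s • (-2 : ℂ) • (Y * T * Y) := by
        rw [lie_lie_of_mul_self_eq_zero ℂ (hY.isSignedShift.mul_self_eq_zero hΨ)]
      _ = -(s * t) • (2 : ℂ) • Z := by
        rw [ht, neg_smul, smul_comm (2 : ℂ) t, smul_neg, smul_smul, Units.neg_smul]
  · obtain ⟨rfl, rfl⟩ := eq_zero_and_eq_zero_of_pairing_ne_zero hΨ hY hZ hk hl hij
    exact ⟨1, by simp⟩

end IsRootVector

end Relations

theorem exists_eq_smul_of_eq_sign_smul {M : Type*} [AddCommGroup M] [Module ℂ M] {x y : M}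
    (h : ∃ s : ℤˣ, x = s • y) : ∃ c : ℂ, c ∈ ({1, -1} : Set ℂ) ∧ x = c • y := by
  obtain ⟨s, rfl⟩ := h
  obtain rfl | rfl := Int.units_eq_one_or s
  · exact ⟨1, by simp⟩
  · exact ⟨-1, by simp⟩

theorem IsRootVectorChoice.exists_lie_eq_smul {ι E N V : Type*} [Finite ι]
    [AddCommGroup E] [Module ℚ E] [AddCommGroup N] [Module ℚ N] [AddCommGroup V] [Module ℂ V]
    {P : RootPairing ι ℚ E N} [P.IsCrystallographic] {b : P.Base} {Ψ : Set E} {z : Basis Ψ ℂ V}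
    {e : E → End ℂ V} {i j k : ι} (he : IsRootVectorChoice b z e) (hΨ : IsMinusculeSet P Ψ)
    (hk : P.root k = P.root i + P.root j) (hne : i ≠ j) (hne' : P.root i ≠ -P.root j) :
    ∃ c : ℂ, c ∈ ({1, -1, 2, -2} : Set ℂ) ∧ ⁅e (P.root i), e (P.root j)⁆ = c • e (P.root k) ∧
      (c ∈ ({2, -2} : Set ℂ) ↔ P.root i - P.root j ∈ roots P) := by
  have hX := he.isRootVector hΨ i
  have hY := he.isRootVector hΨ j
  have hZ := he.isRootVector hΨ k
  by_cases hsub : P.root i - P.root j ∈ roots P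
  · obtain ⟨l, hl⟩ := id hsub
    obtain ⟨c, rfl | rfl, hc⟩ := exists_eq_smul_of_eq_sign_smul
      (hX.lie_eq_two_sign_smul hΨ hY hZ (he.isRootVector hΨ l) hk hl)
    · exact ⟨2, by simp, by rw [hc, one_smul], by simp [hsub]⟩
    · exact ⟨-2, by simp, by rw [hc, neg_one_smul, neg_smul], by simp [hsub]⟩
  · obtain ⟨c, hc, hcZ⟩ := exists_eq_smul_of_eq_sign_smul
      (hX.lie_eq_sign_smul hΨ hY hZ hk hne hne' hsub)
    refine ⟨c, Set.insert_subset_insert (by simp) hc, hcZ, iff_of_false ?_ hsub⟩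
    obtain rfl | rfl := hc <;> norm_num

end MinusculeModel

open MinusculeModel Module in
theorem proposition2p5_general {ι E N V : Type*} [Finite ι]
    [AddCommGroup E] [Module ℚ E] [AddCommGroup N] [Module ℚ N]
    (P : RootPairing ι ℚ E N) [P.IsCrystallographic] (b : P.Base)
    (Ψ : Set E) (hΨ : IsMinusculeSet P Ψ)
    [AddCommGroup V] [Module ℂ V] (z : Basis Ψ ℂ V)
    (e : E → End ℂ V) (he : IsRootVectorChoice b z e)
    (α β : E) (hα : α ∈ roots P) (hβ : β ∈ roots P) (hne : β ≠ α) (hne' : β ≠ -α) :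
    (α + β ∉ roots P → ⁅e α, e β⁆ = 0 ∧ e β * e α * e β = 0) ∧
    (α + β ∈ roots P →
      ∃ c : ℂ, c ∈ ({1, -1, 2, -2} : Set ℂ) ∧ ⁅e α, e β⁆ = c • e (α + β) ∧
        (c ∈ ({2, -2} : Set ℂ) ↔ α - β ∈ roots P)) ∧
    (α + β ∈ roots P → (2 : ℚ) • α + β ∉ roots P →
      (∀ x ∈ ({e α, ⁅e α, e β⁆, e β * e α * e β} : Set (End ℂ V)),
        ∀ y ∈ ({e α, ⁅e α, e β⁆, e β * e α * e β} : Set (End ℂ V)), x * y = 0) ∧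
      (α + (2 : ℚ) • β ∈ roots P →
        ∃ c' : ℂ, c' ∈ ({1, -1} : Set ℂ) ∧ e β * e α * e β = c' • e (α + (2 : ℚ) • β)) ∧
      (α + (2 : ℚ) • β ∉ roots P → e β * e α * e β = 0)) := by
  obtain ⟨i, rfl⟩ := hα
  obtain ⟨j, rfl⟩ := hβ
  have hX := he.isRootVector hΨ i
  have hY := he.isRootVector hΨ j
  have hneg : P.root i ≠ -P.root j := fun h => hne' (neg_eq_iff_eq_neg.2 h).symm
  refine ⟨fun h => ⟨hX.lie_eq_zero hΨ hY hneg h, ?_⟩, fun ⟨k, hk⟩ => ?_, fun _ h => ⟨?_, ?_, ?_⟩⟩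
  · refine hX.isSignedShift.mul_mul_eq_zero hΨ hY.isSignedShift fun hij => h ?_
    exact root_add_root_mem_of_pairing_neg (by norm_num [hij]) hneg
  · rw [← hk]
    exact he.exists_lie_eq_smul hΨ hk (fun h => hne (congrArg P.root h).symm) hneg
  · exact mul_eq_zero_of_mem_brackets (hX.isSignedShift.mul_self_eq_zero hΨ)
      (hY.isSignedShift.mul_self_eq_zero hΨ) (hY.mul_mul_eq_zero hΨ hX (by rwa [add_comm]))
  · rintro ⟨k, hk⟩
    rw [← hk]
    exact exists_eq_smul_of_eq_sign_smul
      (hX.mul_mul_eq_sign_smul hΨ hY (he.isRootVector hΨ k) hk hneg)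
  · exact hX.mul_mul_eq_zero hΨ hY

theorem proposition2p5 {ι E N V : Type*} [Finite ι]
    [AddCommGroup E] [Module ℚ E] [AddCommGroup N] [Module ℚ N]
    (P : RootPairing ι ℚ E N) [P.IsRootSystem] [P.IsCrystallographic] [P.IsReduced]
    [P.IsIrreducible] (b : P.Base)
    (Ψ : Set E) (hΨ : MinusculeModel.IsUnionOfMinusculeOrbits b Ψ)
    [AddCommGroup V] [Module ℂ V] (z : Module.Basis Ψ ℂ V)
    (e : E → Module.End ℂ V) (he : MinusculeModel.IsRootVectorChoice b z e)
    (α β : E) (hα : α ∈ MinusculeModel.roots P) (hβ : β ∈ MinusculeModel.roots P)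
    (hne : β ≠ α) (hne' : β ≠ -α) :
    (α + β ∉ MinusculeModel.roots P → ⁅e α, e β⁆ = 0 ∧ e β * e α * e β = 0) ∧
    (α + β ∈ MinusculeModel.roots P →
      ∃ c : ℂ, c ∈ ({1, -1, 2, -2} : Set ℂ) ∧ ⁅e α, e β⁆ = c • e (α + β) ∧
        (c ∈ ({2, -2} : Set ℂ) ↔ α - β ∈ MinusculeModel.roots P)) ∧
    (α + β ∈ MinusculeModel.roots P → (2 : ℚ) • α + β ∉ MinusculeModel.roots P →
      (∀ x ∈ ({e α, ⁅e α, e β⁆, e β * e α * e β} : Set (Module.End ℂ V)),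
        ∀ y ∈ ({e α, ⁅e α, e β⁆, e β * e α * e β} : Set (Module.End ℂ V)), x * y = 0) ∧
      (α + (2 : ℚ) • β ∈ MinusculeModel.roots P →
        ∃ c' : ℂ, c' ∈ ({1, -1} : Set ℂ) ∧ e β * e α * e β = c' • e (α + (2 : ℚ) • β)) ∧
      (α + (2 : ℚ) • β ∉ MinusculeModel.roots P → e β * e α * e β = 0)) :=
  proposition2p5_general P b Ψ hΨ.isMinusculeSet z e he α β hα hβ hne hne'
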